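/- **Model.** For a configuration $x_1,\dots,x_n\in\mathbb{R}^2$ and $\alpha\ge 0$ let $E(y)=\sum_{i=1}^n \|y-x_i\|^{-\alpha}$ if $\alpha>0$ and $E(y)=\sum_{i=1}^n\log(1/\|y-x_i\|)$ if $\alpha=0$. The configuration has *property (P)* if $E$ has only finitely many critical points in $\mathbb{R}^2\setminus\{x_1,\dots,x_n\}$. A particle started at $z$ follows the gradient ascent flow $\gamma'=\nabla E(\gamma)$, $\gamma(0)=z$, and stops as soon as it has distance $1$ to one of the points $x_i$. The law of a particle *coming from infinity* is the weak limit, as $r\to\infty$, of the law of the stopping position of a particle started uniformly at random on the circle $\{\|z\|=r\}$. *Gradient Flow Aggregation* (GFA) with parameter $\alpha$ is a random sequence $(x_k)_{k\ge1}$ in $\mathbb{R}^2$ such that $x_1$ is a fixed point and, for every $n\ge1$, the conditional law of $x_{n+1}$ given $x_1,\dots,x_n$ is the law of a particle coming from infinity for the configuration $x_1,\dots,x_n$. **Theorem 3 (Growth Bound).** Let $0\le\alpha\le1$. There is a constant $c_\alpha>0$, depending only on $\alpha$, such that for every GFA $(x_k)_{k\ge1}$ with parameter $\alpha$ for which, almost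 surely, $\{x_1,\dots,x_n\}$ has property (P) for every $n\ge1$, the bound $$\operatorname{diam}\{x_1,\dots,x_n\}\le c_\alpha\, n^{\frac{3\alpha+1}{2\alpha+2}}$$ holds with high probability, that is, with probability tending to $1$ as $n\to\infty$, and moreover almost surely for all sufficiently large $n$. The bound is optimal for $\alpha=0$: there is a constant $c>0$ such that for every GFA with $\alpha=0$, almost surely $\operatorname{diam}\{x_1,\dots,x_n\}\ge c\,n^{1/2}$ for all $n\ge2$. -/

import Mathlib

open MeasureTheory ProbabilityTheory Filter Topology

namespace GFA

/-- The Euclidean plane. -/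
abbrev Plane : Type := EuclideanSpace ℝ (Fin 2)

/-- The energy of the configuration `x` of `n` particles: `∑ ‖y - x i‖ ^ (-α)` for `α ≠ 0` and the
logarithmic energy `∑ log (1 / ‖y - x i‖)` for `α = 0`. It is only ever used away from the
particles. -/
noncomputable def energy (α : ℝ) {n : ℕ} (x : Fin n → Plane) (y : Plane) : ℝ :=
  if α = 0 then ∑ i, Real.log (1 / ‖y - x i‖) else ∑ i, 1 / ‖y - x i‖ ^ α

/-- Property (P): the energy, which lives on the complement of the particles, has only finitely
many critical points. -/
def PropertyP (α : ℝ) {n : ℕ} (x : Fin n → Plane) : Prop :=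
  {y : Plane | y ∉ Set.range x ∧ gradient (energy α x) y = 0}.Finite

/-- The gradient ascent flow `γ' = ∇E(γ)` started in `z` reaches distance `1` to one of the
particles, for the first time, in the point `y` (at the time `T`). -/
def FlowStopsAt (α : ℝ) {n : ℕ} (x : Fin n → Plane) (z y : Plane) : Prop :=
  ∃ (T : ℝ) (γ : ℝ → Plane), 0 ≤ T ∧ γ 0 = z ∧ γ T = y ∧
    (∀ t ∈ Set.Icc 0 T,
      HasDerivWithinAt γ (gradient (energy α x) (γ t)) (Set.Icc 0 T) t) ∧
    (∀ t ∈ Set.Ico 0 T, ∀ i, 1 < dist (γ t) (x i)) ∧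
    (∀ i, 1 ≤ dist y (x i)) ∧ ∃ i, dist y (x i) = 1

/-- The point at distance `r` from the origin in the direction `θ`. -/
noncomputable def circlePoint (r θ : ℝ) : Plane := !₂[r * Real.cos θ, r * Real.sin θ]

/-- The probability that the flow started in a uniformly distributed point of the circle
`‖z‖ = r` stops in a point of `J`. -/
noncomputable def stopProb (α : ℝ) {n : ℕ} (x : Fin n → Plane) (r : ℝ) (J : Set Plane) :
    ENNReal :=
  volume {θ : ℝ | θ ∈ Set.Ioc 0 (2 * Real.pi) ∧ ∃ y ∈ J, FlowStopsAt α x (circlePoint r θ) y} /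
    ENNReal.ofReal (2 * Real.pi)

/-- `ν` is the law of the final position of a particle that comes from infinity in a uniformly
random direction: `ν` is the weak limit, as `r → ∞`, of the laws of the final positions of the
particles started uniformly on the circle `‖z‖ = r` (weak convergence is convergence on all Borel
sets whose boundary is a null set of the limit). -/
def IsLawFromInfinity (α : ℝ) {n : ℕ} (x : Fin n → Plane) (ν : Measure Plane) : Prop :=
  IsProbabilityMeasure ν ∧
    ∀ J : Set Plane, MeasurableSet J → ν (frontier J) = 0 →
      Tendsto (fun r : ℝ => stopProb α x r J) atTop (𝓝 (ν J))

/-- The random sequence `X 0, X 1, X 2, …` of points of the plane is obtained via gradient flow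
aggregation with parameter `α`: it starts with one fixed particle, and the conditional distribution
of the next particle given all the previous ones is the law of a particle that comes from infinity
and flows along the gradient of the energy of the previous particles. -/
structure IsGFA {Ω : Type*} [MeasurableSpace Ω] (μ : Measure Ω) [IsProbabilityMeasure μ]
    (α : ℝ) (X : ℕ → Ω → Plane) : Prop where
  measurable : ∀ k, Measurable (X k)
  start : ∃ x₁ : Plane, ∀ᵐ ω ∂μ, X 0 ω = x₁
  step : ∀ n : ℕ, 1 ≤ n → ∀ᵐ ω ∂μ,
    IsLawFromInfinity α (fun i : Fin n => X i ω)
      (condDistrib (X n) (fun (ω' : Ω) (i : Fin n) => X i ω') μ (fun i : Fin n => X i ω))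

/-- The diameter of the set of the first `n` particles. -/
noncomputable def clusterDiam {Ω : Type*} (X : ℕ → Ω → Plane) (n : ℕ) (ω : Ω) : ℝ :=
  Metric.diam {p : Plane | ∃ k < n, X k ω = p}

end GFA

/-! Divide the force `F = ∑ ‖y - x i‖ ^ (-α - 2) • (x i - y)` by `Q = ∑ ‖y - x i‖ ^ (-α)`. The
resulting field `W = F / Q` has the same trajectories as `∇E` up to a change of time. Since `∇Q = α
F` and `div F = α S` with `S = ∑ ‖y - x i‖ ^ (-α - 2)`, its divergence is `α (Q S - ‖F‖²) / Q²`,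
which is nonnegative by Cauchy–Schwarz. So the flow of `W` never shrinks area.

This gives a Beurling estimate. Let `Z` be the set of starting points in an annulus `r ≤ ‖w‖ ≤ r +
1` whose trajectories come close to `x i`. If `‖W‖ ≤ M` near `x i`, each of them spends time of
order `1 / M` in a fixed ball around `x i`. A point of that ball can be occupied only during a time
window of length `O(r)`, because trajectories cross the annulus at a definite speed. Integrating
over time, `|Z| / M ≤ O(r)`, so the probability of attaching to `x i` is `O(M)`
(`IsLawFromInfinity.closedBall_le`). The argument is run on Euler orbits, which shadow the
trajectories (`exists_eulerStep_shadow`), with sums over steps in place of time integrals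
(`volume_le_of_iterate_eulerStep_mem_ball`).

For `n` particles at mutual distance at least `1` and diameter at most `2 n`, packing bounds `∑ ‖y -
x i‖ ^ (-α - 1)` by a multiple of `n ^ ((1 - α) / 2)`, while `Q` is at least of order `n ^ (1 - α)`.
Hence `M` is of order `p n = n ^ (-(1 - α) / 2)` for `α < 1`.

A distant particle forces a long chain of attachments. The expected number of chains of length `L`
among `N` particles is at most `(C ∑ p k) ^ L / L!`, which is at most `exp (-L)` once `L` exceeds a
large multiple of `N ^ ((1 + α) / 2)`. Markov and Borel–Cantelli conclude, since `(1 + α) / 2 ≤ (3 α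
+ 1) / (2 α + 2)` on `[0, 1]`. For `α = 1` the exponent is `1` and the trivial linear bound
suffices. The lower bound is packing of disjoint discs. -/

namespace GFA

/-! ### Euler steps and area -/

/-- One step of size `h` of the Euler scheme for the vector field `W`. -/
noncomputable def eulerStep {E : Type*} [NormedAddCommGroup E] [NormedSpace ℝ E] (W : E → E)
    (h : ℝ) (y : E) : E := y + h • W y

/-- For `h * L < 1` the displacement `h • W` is a strict contraction on `K`, so it cannot compensate
the difference of two distinct points. -/
theorem eulerStep_injOn {E : Type*} [NormedAddCommGroup E] [NormedSpace ℝ E] {W : E → E}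
    {K : Set E} {L : NNReal} (hL : LipschitzOnWith L W K) {h : ℝ} (h0 : 0 ≤ h) (hh : h * L < 1) :
    Set.InjOn (eulerStep W h) K := by
  intro a ha b hb hab
  by_contra hne
  have hpos : 0 < ‖a - b‖ := norm_pos_iff.2 (sub_ne_zero.2 hne)
  have h1 : a - b = h • (W b - W a) := by
    simp only [eulerStep] at hab
    rw [smul_sub, sub_eq_sub_iff_add_eq_add, add_comm (h • W b), hab]
  have h2 : ‖W b - W a‖ ≤ L * ‖a - b‖ := by
    have := hL.dist_le_mul b hb a ha
    rwa [dist_eq_norm, dist_eq_norm, norm_sub_rev b a] at this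
  have h3 : ‖a - b‖ ≤ h * (L * ‖a - b‖) := by
    calc ‖a - b‖ = h * ‖W b - W a‖ := by
          conv_lhs => rw [h1]
          rw [norm_smul, Real.norm_of_nonneg h0]
      _ ≤ _ := by gcongr
  nlinarith

theorem det_id_add_smul (A : Plane →L[ℝ] Plane) (h : ℝ) :
    (ContinuousLinearMap.id ℝ Plane + h • A).det =
      1 + h * LinearMap.trace ℝ Plane A + h ^ 2 * A.det := by
  let b := (EuclideanSpace.basisFun (Fin 2) ℝ).toBasis
  simp only [ContinuousLinearMap.det]
  rw [← LinearMap.det_toMatrix b, ← LinearMap.det_toMatrix b, LinearMap.trace_eq_matrix_trace ℝ b]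
  have : LinearMap.toMatrix b b (ContinuousLinearMap.id ℝ Plane + h • A : Plane →L[ℝ] Plane) =
      1 + h • LinearMap.toMatrix b b A := by
    rw [← LinearMap.toMatrix_id b, ← map_smul, ← map_add]
    rfl
  rw [this]
  simp only [Matrix.det_fin_two, Matrix.trace_fin_two, Matrix.add_apply, Matrix.smul_apply,
    Matrix.one_apply, smul_eq_mul]
  simp
  ring

/-- An Euler step of a vector field with nonnegative divergence shrinks areas by a factor at
least `1 - h ^ 2 * C`. -/
theorem volume_image_eulerStep {W : Plane → Plane} {W' : Plane → Plane →L[ℝ] Plane} {K : Set Plane}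
    {L : NNReal} (hL : LipschitzOnWith L W K) {h C : ℝ} (h0 : 0 ≤ h) (hh : h * L < 1)
    (hW : ∀ y ∈ K, HasFDerivAt W (W' y) y) (htr : ∀ y ∈ K, 0 ≤ LinearMap.trace ℝ Plane (W' y))
    (hdet : ∀ y ∈ K, |(W' y).det| ≤ C) {s : Set Plane} (hs : MeasurableSet s) (hsK : s ⊆ K) :
    ENNReal.ofReal (1 - h ^ 2 * C) * volume s ≤ volume (eulerStep W h '' s) := by
  have hd : ∀ y ∈ s, HasFDerivWithinAt (eulerStep W h)
      (ContinuousLinearMap.id ℝ Plane + h • W' y) s y := fun y hy =>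
    ((hasFDerivAt_id y).add ((hW y (hsK hy)).const_smul h)).hasFDerivWithinAt
  rw [← lintegral_abs_det_fderiv_eq_addHaar_image volume hs hd
    ((eulerStep_injOn hL h0 hh).mono hsK), ← setLIntegral_const]
  refine setLIntegral_mono' hs fun y hy => ENNReal.ofReal_le_ofReal ?_
  rw [det_id_add_smul]
  refine le_trans ?_ (le_abs_self _)
  have h1 := htr y (hsK hy)
  have h2 := (abs_le.1 (hdet y (hsK hy))).1
  nlinarith [mul_nonneg h0 h1, mul_le_mul_of_nonneg_left h2 (sq_nonneg h)]

theorem iterate_injOn {E : Type*} {F : E → E} {K : Set E} (hF : Set.InjOn F K) (k : ℕ) :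
    Set.InjOn F^[k] {w | ∀ j < k, F^[j] w ∈ K} := by
  induction k with
  | zero => intro a _ b _ hab; simpa using hab
  | succ k ih =>
    intro a ha b hb hab
    rw [Function.iterate_succ_apply', Function.iterate_succ_apply'] at hab
    exact ih (fun j hj => ha j (by omega)) (fun j hj => hb j (by omega))
      (hF (ha k (by omega)) (hb k (by omega)) hab)

theorem measurableSet_image_iterate {E : Type*} [TopologicalSpace E] [PolishSpace E]
    [MeasurableSpace E] [BorelSpace E] {F : E → E} {K : Set E} (hF : Set.InjOn F K)
    (hc : ContinuousOn F K) (k : ℕ) {s : Set E} (hs : MeasurableSet s)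
    (hsK : ∀ w ∈ s, ∀ j < k, F^[j] w ∈ K) : MeasurableSet (F^[k] '' s) := by
  induction k with
  | zero => simpa using hs
  | succ k ih =>
    have h1 := ih fun w hw j hj => hsK w hw j (by omega)
    have h2 : F^[k + 1] '' s = F '' (F^[k] '' s) := by
      rw [← Set.image_comp, Function.iterate_succ']
    have h3 : F^[k] '' s ⊆ K := by
      rintro _ ⟨w, hw, rfl⟩
      exact hsK w hw k (by omega)
    rw [h2]
    exact h1.image_of_continuousOn_injOn (hc.mono h3) (hF.mono h3)

theorem volume_image_iterate_eulerStep {W : Plane → Plane} {W' : Plane → Plane →L[ℝ] Plane}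
    {K : Set Plane} {L : NNReal} (hL : LipschitzOnWith L W K) {h C : ℝ} (h0 : 0 ≤ h)
    (hh : h * L < 1)
    (hW : ∀ y ∈ K, HasFDerivAt W (W' y) y) (htr : ∀ y ∈ K, 0 ≤ LinearMap.trace ℝ Plane (W' y))
    (hdet : ∀ y ∈ K, |(W' y).det| ≤ C) (k : ℕ) {s : Set Plane} (hs : MeasurableSet s)
    (hsK : ∀ w ∈ s, ∀ j < k, (eulerStep W h)^[j] w ∈ K) :
    ENNReal.ofReal (1 - h ^ 2 * C) ^ k * volume s ≤ volume ((eulerStep W h)^[k] '' s) := by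
  have hc : ContinuousOn (eulerStep W h) K := fun y hy =>
    (continuousAt_id.add ((hW y hy).continuousAt.const_smul h)).continuousWithinAt
  induction k with
  | zero => simp
  | succ k ih =>
    have h1 := ih fun w hw j hj => hsK w hw j (by omega)
    have h2 : (eulerStep W h)^[k + 1] '' s = eulerStep W h '' ((eulerStep W h)^[k] '' s) := by
      rw [← Set.image_comp, Function.iterate_succ']
    have h3 : (eulerStep W h)^[k] '' s ⊆ K := by
      rintro _ ⟨w, hw, rfl⟩
      exact hsK w hw k (by omega)
    rw [h2, pow_succ', mul_assoc]
    refine le_trans (mul_le_mul_right h1 _) (volume_image_eulerStep hL h0 hh hW htr hdet ?_ h3)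
    exact measurableSet_image_iterate (eulerStep_injOn hL h0 hh) hc k hs
      fun w hw j hj => hsK w hw j (by omega)

/-! ### Counting overlaps of families of sets -/

open Classical in
/-- If every point lies in at most `N` of the sets `B k`, and all of them are contained in `S`,
then the measures of the `B k` add up to at most `N` times the measure of `S`. -/
theorem sum_measure_le_of_card_le {E : Type*} [MeasurableSpace E] (μ : Measure E) {B : ℕ → Set E}
    {S : Set E} (m N : ℕ) (hB : ∀ k, MeasurableSet (B k)) (hS : MeasurableSet S)
    (hBS : ∀ k, B k ⊆ S)
    (hN : ∀ y, ((Finset.range m).filter fun k => y ∈ B k).card ≤ N) :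
    ∑ k ∈ Finset.range m, μ (B k) ≤ N * μ S := by
  calc ∑ k ∈ Finset.range m, μ (B k)
      = ∑ k ∈ Finset.range m, ∫⁻ y, (B k).indicator 1 y ∂μ := by
        simp [hB]
    _ = ∫⁻ y, ∑ k ∈ Finset.range m, (B k).indicator 1 y ∂μ := by
        rw [lintegral_finsetSum _ fun k _ => measurable_one.indicator (hB k)]
    _ ≤ ∫⁻ y, S.indicator (fun _ => (N : ENNReal)) y ∂μ := by
        refine lintegral_mono fun y => ?_
        by_cases hy : y ∈ S
        · simp only [Set.indicator_of_mem hy, Set.indicator_apply, Pi.one_apply]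
          rw [Finset.sum_boole]
          exact_mod_cast hN y
        · have : ∀ k, y ∉ B k := fun k hk => hy (hBS k hk)
          simp [this]
    _ = N * μ S := by rw [lintegral_indicator hS, setLIntegral_const]

open Classical in
/-- If every point of `Z` lies in at least `N` of the sets `A k`, then `N` times the outer measure
of `Z` is at most the sum of the measures of the `A k`. -/
theorem measure_mul_le_sum_of_le_card {E : Type*} [MeasurableSpace E] (μ : Measure E)
    {A : ℕ → Set E} {Z : Set E} (m N : ℕ) (hA : ∀ k, MeasurableSet (A k))
    (hN : ∀ y ∈ Z, N ≤ ((Finset.range m).filter fun k => y ∈ A k).card) :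
    N * μ Z ≤ ∑ k ∈ Finset.range m, μ (A k) := by
  have hm : Measurable fun y => ∑ k ∈ Finset.range m, (A k).indicator (1 : E → ENNReal) y :=
    Finset.measurable_fun_sum _ fun k _ => measurable_one.indicator (hA k)
  calc N * μ Z
      ≤ N * μ {y | (N : ENNReal) ≤ ∑ k ∈ Finset.range m, (A k).indicator 1 y} := by
        gcongr
        intro y hy
        simp only [Set.mem_ofPred_eq, Set.indicator_apply, Pi.one_apply]
        rw [Finset.sum_boole]
        exact_mod_cast hN y hy
    _ ≤ ∫⁻ y, ∑ k ∈ Finset.range m, (A k).indicator 1 y ∂μ :=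
        mul_meas_ge_le_lintegral hm _
    _ = ∑ k ∈ Finset.range m, ∫⁻ y, (A k).indicator 1 y ∂μ := by
        rw [lintegral_finsetSum _ fun k _ => measurable_one.indicator (hA k)]
    _ = _ := by simp [hA]

end GFA

/-! ### Visits of Euler orbits to a ball -/

namespace GFA

theorem card_le_of_forall_sub_lt {s : Finset ℕ} {N : ℕ}
    (h : ∀ a ∈ s, ∀ b ∈ s, a ≤ b → b - a < N) : s.card ≤ N := by
  rcases s.eq_empty_or_nonempty with rfl | hs
  · simp
  have hsub : s ⊆ Finset.Ico (s.min' hs) (s.min' hs + N) := fun b hb => by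
    have h1 := s.min'_le b hb
    have h2 := h _ (s.min'_mem hs) b hb h1
    exact Finset.mem_Ico.2 ⟨h1, by omega⟩
  simpa using Finset.card_le_card hsub

/-- The Euler orbits of a vector field that points inwards far out cross an annulus in a bounded
number of steps. -/
theorem norm_iterate_eulerStep {W : Plane → Plane} {K : Set Plane}
    (hW2 : ∀ y ∈ K, ‖W y‖ ≤ 2) {D r h : ℝ} (h0 : 0 < h) (h8 : h ≤ 1 / 8)
    (hin : ∀ y ∈ K, D ≤ ‖y‖ → inner ℝ y (W y) ≤ -(1 / 2)) (hr : D + 1 ≤ r) (hD : 0 ≤ D)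
    {w : Plane} (hw : ‖w‖ ≤ r + 1) (k : ℕ) (hk : ∀ j < k, (eulerStep W h)^[j] w ∈ K) :
    ‖(eulerStep W h)^[k] w‖ ^ 2 ≤ (r + 1) ^ 2 - k * (h / 2) ∨ ‖(eulerStep W h)^[k] w‖ < r := by
  induction k with
  | zero => left; simp; gcongr
  | succ k ih =>
    have hK := hk k (by omega)
    have ih := ih fun j hj => hk j (by omega)
    rw [Function.iterate_succ_apply']
    set q := (eulerStep W h)^[k] w
    have hq2 := hW2 q hK
    rcases lt_or_ge ‖q‖ D with hqD | hqD
    · right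
      calc ‖eulerStep W h q‖ ≤ ‖q‖ + ‖h • W q‖ := norm_add_le _ _
        _ = ‖q‖ + h * ‖W q‖ := by rw [norm_smul, Real.norm_of_nonneg h0.le]
        _ < r := by nlinarith
    · have h1 := hin q hK hqD
      -- The inner product contributes at most `-h` and the quadratic term at most `4 * h ^ 2`,
      -- which is at most `h / 2` because `h ≤ 1 / 8`.
      have h2 : ‖eulerStep W h q‖ ^ 2 ≤ ‖q‖ ^ 2 - h / 2 := by
        rw [eulerStep, norm_add_sq_real, inner_smul_right, norm_smul, Real.norm_of_nonneg h0.le]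
        have : ‖W q‖ ^ 2 ≤ 4 := by nlinarith [norm_nonneg (W q)]
        nlinarith [mul_le_mul_of_nonneg_left h1 h0.le, mul_le_mul_of_nonneg_left this (sq_nonneg h)]
      rcases ih with ih | ih
      · left; push_cast; linarith
      · right
        nlinarith [norm_nonneg q, norm_nonneg (eulerStep W h q)]

/-- The starting points in the annulus `r ≤ ‖w‖ ≤ r + 1` whose orbit under `F` stays in `K` up to
time `k`, when it lies in the ball of radius `4` around `p`. -/
def visitSet (F : Plane → Plane) (K : Set Plane) (r : ℝ) (p : Plane) (k : ℕ) : Set Plane :=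
  ({w | r ≤ ‖w‖} ∩ {w | ‖w‖ ≤ r + 1}) ∩
    ({w | ∀ j ≤ k, F^[j] w ∈ K} ∩ F^[k] ⁻¹' Metric.ball p 4)

theorem measurableSet_visitSet {F : Plane → Plane} (hF : Measurable F) {K : Set Plane}
    (hK : MeasurableSet K) (r : ℝ) (p : Plane) (k : ℕ) : MeasurableSet (visitSet F K r p k) := by
  refine MeasurableSet.inter ?_ (MeasurableSet.inter ?_ (hF.iterate k measurableSet_ball))
  · exact (measurableSet_le measurable_const measurable_norm).inter
      (measurableSet_le measurable_norm measurable_const)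
  · have : {w | ∀ j ≤ k, F^[j] w ∈ K} = ⋂ j, ⋂ (_ : j ≤ k), F^[j] ⁻¹' K := by
      ext w; simp
    rw [this]
    exact MeasurableSet.iInter fun j => MeasurableSet.iInter fun _ => hF.iterate j hK

open Classical in
-- Follow the orbit backwards from its arrival within `5 / 2` of `p`: at speed at most `M` it needs
-- about `1 / (h * M)` steps to move by `1`, so that many earlier positions still lie in the ball of
-- radius `4`.
theorem card_visitSet_ge {W : Plane → Plane} {K : Set Plane} {r h M : ℝ} {p w : Plane} {k m J : ℕ}
    (hW2 : ∀ y ∈ K, ‖W y‖ ≤ 2) (hWM : ∀ y ∈ K, dist y p ≤ 5 → ‖W y‖ ≤ M) (hp : ‖p‖ + 4 ≤ r)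
    (hpos : 0 < h) (h8 : h ≤ 1 / 8) (hkm : k < m) (hJ : ∀ j < J, j * (h * M) ≤ 1)
    (hw : r ≤ ‖w‖) (hw' : ‖w‖ ≤ r + 1)
    (hkK : ∀ j ≤ k, (eulerStep W h)^[j] w ∈ K)
    (hkp : dist ((eulerStep W h)^[k] w) p ≤ 5 / 2) :
    J ≤ ((Finset.range m).filter fun k => w ∈ visitSet (eulerStep W h) K r p k).card := by
  have hclose : ∀ j, j ≤ k → j < J →
      dist ((eulerStep W h)^[k - j] w) p ≤ 5 / 2 + j * (h * M) := by
    intro j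
    induction j with
    | zero => intro _ _; simpa using hkp
    | succ j ih =>
      intro hjk hjJ
      have ih := ih (by omega) (by omega)
      have e : k - j = (k - (j + 1)) + 1 := by omega
      have hqK := hkK (k - (j + 1)) (by omega)
      rw [e, Function.iterate_succ_apply'] at ih
      generalize (eulerStep W h)^[k - (j + 1)] w = q at ih hqK ⊢
      have hd : dist q (eulerStep W h q) = h * ‖W q‖ := by
        rw [eulerStep, dist_eq_norm, sub_add_cancel_left, norm_neg, norm_smul,
          Real.norm_of_nonneg hpos.le]
      have h1 := dist_triangle q (eulerStep W h q) p
      have h2 := mul_le_mul_of_nonneg_left (hW2 q hqK) hpos.le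
      have h3 := hJ j (by omega)
      -- The crude speed bound `2` already keeps the previous point within `5 / 2 + 1 + 1 / 4` of
      -- `p`, where the better bound `M` applies.
      have h4 : dist q p ≤ 5 := by linarith
      have h5 := mul_le_mul_of_nonneg_left (hWM q hqK h4) hpos.le
      push_cast
      linarith
  -- Otherwise the backward walk would reach the starting point while still within `7 / 2` of `p`,
  -- but the annulus is at distance at least `4` from `p`.
  have hJk : J ≤ k := by
    by_contra! hlt
    have h1 := hclose k le_rfl hlt
    have h2 := hJ k hlt
    simp only [Nat.sub_self, Function.iterate_zero, id] at h1
    have h4 : ‖w‖ ≤ dist w p + ‖p‖ := by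
      have := norm_add_le (w - p) p
      rwa [sub_add_cancel, ← dist_eq_norm] at this
    linarith
  have hsub : (Finset.range J).image (fun j => k - j) ⊆
      (Finset.range m).filter fun k => w ∈ visitSet (eulerStep W h) K r p k := by
    intro l hl
    obtain ⟨j, hj, rfl⟩ := Finset.mem_image.1 hl
    have hj := Finset.mem_range.1 hj
    refine Finset.mem_filter.2 ⟨Finset.mem_range.2 (by omega), ⟨hw, hw'⟩,
      fun i hi => hkK i (by omega), ?_⟩
    have h1 := hclose j (by omega) hj
    have h2 := hJ j hj
    rw [Set.mem_preimage, Metric.mem_ball]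
    linarith
  calc J = ((Finset.range J).image (fun j => k - j)).card := by
        rw [Finset.card_image_of_injOn, Finset.card_range]
        intro a ha b hb hab
        have ha := Finset.mem_range.1 ha
        have hb := Finset.mem_range.1 hb
        simp only at hab
        omega
    _ ≤ _ := Finset.card_le_card hsub

open Classical in
-- If `y` is reached at times `a ≤ b`, injectivity makes the first starting point the position at
-- time `b - a` of the second orbit. Both lie in the annulus, where the squared norm varies by at
-- most `2 * r + 1` and drops by `h / 2` per step; this gives `(4 * r + 2) / h`.
theorem card_image_visitSet_le {W : Plane → Plane} {K : Set Plane} {r h D : ℝ} {p : Plane}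
    {m N : ℕ} (hW2 : ∀ y ∈ K, ‖W y‖ ≤ 2)
    (hin : ∀ y ∈ K, D ≤ ‖y‖ → inner ℝ y (W y) ≤ -(1 / 2)) (hr : D + 1 ≤ r) (hD : 0 ≤ D)
    (hpos : 0 < h) (h8 : h ≤ 1 / 8) (hinj : Set.InjOn (eulerStep W h) K)
    (hN : (4 * r + 2) / h < N) (y : Plane) :
    ((Finset.range m).filter fun k =>
      y ∈ (eulerStep W h)^[k] '' visitSet (eulerStep W h) K r p k).card ≤ N := by
  refine card_le_of_forall_sub_lt fun a ha b hb hab => ?_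
  obtain ⟨u, hu, huy⟩ := (Finset.mem_filter.1 ha).2
  obtain ⟨v, hv, hvy⟩ := (Finset.mem_filter.1 hb).2
  have e : b = a + (b - a) := by omega
  have huv : u = (eulerStep W h)^[b - a] v := by
    refine iterate_injOn hinj a (fun j hj => hu.2.1 j hj.le) ?_ ?_
    · intro j hj
      rw [← Function.iterate_add_apply]
      exact hv.2.1 _ (by omega)
    · rw [huy, ← Function.iterate_add_apply, ← e, hvy]
  have h1 := norm_iterate_eulerStep hW2 hpos h8 hin hr hD hv.1.2 (b - a)
    (fun j hj => hv.2.1 j (by omega))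
  rw [← huv] at h1
  have h2 : r ≤ ‖u‖ := hu.1.1
  rcases h1 with h1 | h1
  · have h3 : ((b - a : ℕ) : ℝ) ≤ (4 * r + 2) / h := by
      rw [le_div_iff₀ hpos]
      nlinarith
    exact_mod_cast h3.trans_lt hN
  · linarith

/-- Each Euler step may lose a factor `1 - h ^ 2 * C`. Over at most `T / h` steps, Bernoulli's
inequality bounds the total loss by `h * T * C ≤ 1 / 2`, which costs the factor `2`. -/
theorem volume_visitSet_le {W : Plane → Plane}
    {W' : Plane → Plane →L[ℝ] Plane} {K : Set Plane}
    (hWm : Measurable W) (hKm : MeasurableSet K)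
    {L : NNReal} (hL : LipschitzOnWith L W K) {C : ℝ} (hC : 0 ≤ C)
    (hW : ∀ y ∈ K, HasFDerivAt W (W' y) y) (htr : ∀ y ∈ K, 0 ≤ LinearMap.trace ℝ Plane (W' y))
    (hdet : ∀ y ∈ K, |(W' y).det| ≤ C) {h r T : ℝ} {p : Plane} {k : ℕ} (hpos : 0 < h)
    (hhL : h * L < 1) (hhC : h * (T * C) ≤ 1 / 2) (hk : k * h ≤ T) :
    volume (visitSet (eulerStep W h) K r p k) ≤
      2 * volume ((eulerStep W h)^[k] '' visitSet (eulerStep W h) K r p k) := by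
  have hFm : Measurable (eulerStep W h) := measurable_id.add (hWm.const_smul h)
  have h1 := volume_image_iterate_eulerStep hL hpos.le hhL hW htr hdet k
    (measurableSet_visitSet hFm hKm r p k) (fun w hw j hj => hw.2.1 j hj.le)
  have h3 : (2 : ENNReal)⁻¹ ≤ ENNReal.ofReal (1 - h ^ 2 * C) ^ k := by
    rcases Nat.eq_zero_or_pos k with rfl | hkpos
    · simp
    have h3 : h * C * (k * h) ≤ 1 / 2 := by
      calc h * C * (k * h) ≤ h * C * T := by gcongr
        _ ≤ 1 / 2 := by linarith
    have h4 : h ^ 2 * C ≤ 1 / 2 := by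
      have : (1 : ℝ) ≤ k := by exact_mod_cast hkpos
      nlinarith [mul_nonneg (sq_nonneg h) hC]
    have h5 := one_add_mul_le_pow (a := -(h ^ 2 * C)) (by linarith) k
    rw [← sub_eq_add_neg] at h5
    rw [← ENNReal.ofReal_pow (by linarith)]
    calc (2 : ENNReal)⁻¹ = ENNReal.ofReal (1 / 2) := by
          rw [one_div, ENNReal.ofReal_inv_of_pos two_pos]; simp
      _ ≤ _ := ENNReal.ofReal_le_ofReal (by nlinarith)
  calc volume (visitSet (eulerStep W h) K r p k)
      = 2 * (2⁻¹ * volume (visitSet (eulerStep W h) K r p k)) := by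
        rw [← mul_assoc, ENNReal.mul_inv_cancel two_ne_zero ENNReal.ofNat_ne_top, one_mul]
    _ ≤ _ := by
        gcongr
        exact (mul_le_mul_left h3 _).trans h1

theorem exists_pos_small {h₀ a b : ℝ} (h₀pos : 0 < h₀) :
    ∃ h : ℝ, 0 < h ∧ h < h₀ ∧ h ≤ 1 / 8 ∧ h * a < 1 ∧ h * b ≤ 1 / 2 := by
  have e0 : ∀ᶠ h : ℝ in 𝓝[>] 0, 0 < h := self_mem_nhdsWithin
  have e1 : ∀ c > 0, ∀ᶠ h : ℝ in 𝓝[>] 0, h < c := fun c hc =>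
    nhdsWithin_le_nhds (eventually_lt_nhds hc)
  have e3 : ∀ c : ℝ, ∀ b : ℝ, 0 < b → ∀ᶠ h : ℝ in 𝓝[>] 0, h * c < b := fun c b hb => by
    have : Tendsto (fun h : ℝ => h * c) (𝓝 0) (𝓝 0) := by
      simpa using (tendsto_id (α := ℝ) (x := 𝓝 0)).mul_const c
    exact nhdsWithin_le_nhds (this.eventually (eventually_lt_nhds hb))
  obtain ⟨h, h1, h2, h3, h4, h5⟩ := (e0.and ((e1 _ h₀pos).and ((e1 (1 / 8) (by norm_num)).and
    ((e3 a 1 one_pos).and (e3 b (1 / 2) (by norm_num)))))).exists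
  exact ⟨h, h1, h2, h3.le, h4, h5.le⟩

/-- Euler orbits of a vector field with nonnegative divergence: the outer measure of the set of
those starting points in an annulus whose orbits get close to `p` is controlled by the speed of
the vector field near `p`. -/
theorem volume_le_of_iterate_eulerStep_mem_ball {W : Plane → Plane}
    {W' : Plane → Plane →L[ℝ] Plane} {K : Set Plane}
    (hWm : Measurable W) (hKm : MeasurableSet K)
    {L : NNReal} (hL : LipschitzOnWith L W K) {C : ℝ} (hC : 0 ≤ C)
    (hW : ∀ y ∈ K, HasFDerivAt W (W' y) y) (htr : ∀ y ∈ K, 0 ≤ LinearMap.trace ℝ Plane (W' y))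
    (hdet : ∀ y ∈ K, |(W' y).det| ≤ C)
    (hW2 : ∀ y ∈ K, ‖W y‖ ≤ 2) {D r M : ℝ} {p : Plane}
    (hin : ∀ y ∈ K, D ≤ ‖y‖ → inner ℝ y (W y) ≤ -(1 / 2)) (hr : D + 1 ≤ r) (hD : 0 ≤ D)
    (hM : 0 < M) (hWM : ∀ y ∈ K, dist y p ≤ 5 → ‖W y‖ ≤ M) (hp : ‖p‖ + 4 ≤ r)
    {Z : Set Plane} (hZ : ∀ w ∈ Z, r ≤ ‖w‖ ∧ ‖w‖ ≤ r + 1) {T h₀ : ℝ} (hT : 0 ≤ T) (h₀pos : 0 < h₀)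
    (horb : ∀ h, 0 < h → h < h₀ → ∀ w ∈ Z, ∃ k : ℕ, k * h ≤ T ∧
      (∀ j ≤ k, (eulerStep W h)^[j] w ∈ K) ∧ dist ((eulerStep W h)^[k] w) p ≤ 5 / 2) :
    volume Z ≤ ENNReal.ofReal (224 * Real.pi * r * M) := by
  classical
  have hr1 : 1 ≤ r := by linarith
  -- The step is small enough for shadowing, for the inward drift, for injectivity and for a total
  -- area loss of at most one half.
  obtain ⟨h, hpos, hh0, hh8, hhL, hhC⟩ := exists_pos_small (a := L) (b := T * C) h₀pos
  have hFm : Measurable (eulerStep W h) := measurable_id.add (hWm.const_smul h)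
  have hinj : Set.InjOn (eulerStep W h) K := eulerStep_injOn hL hpos.le hhL
  have hc : ContinuousOn (eulerStep W h) K := fun y hy =>
    (continuousAt_id.add ((hW y hy).continuousAt.const_smul h)).continuousWithinAt
  -- Here `m` exceeds the number of steps up to time `T`, `N` bounds the steps needed to cross the
  -- annulus, and `J` is the number of steps spent near `p`.
  obtain ⟨m, hm⟩ : ∃ m : ℕ, m = ⌊T / h⌋₊ + 1 := ⟨_, rfl⟩
  obtain ⟨N, hN⟩ : ∃ N : ℕ, N = ⌊(4 * r + 2) / h⌋₊ + 1 := ⟨_, rfl⟩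
  obtain ⟨J, hJ⟩ : ∃ J : ℕ, J = ⌈1 / (h * M)⌉₊ := ⟨_, rfl⟩
  have hhM : 0 < h * M := mul_pos hpos hM
  have hlow : J * volume Z ≤
      ∑ k ∈ Finset.range m, volume (visitSet (eulerStep W h) K r p k) := by
    refine measure_mul_le_sum_of_le_card volume m J (measurableSet_visitSet hFm hKm r p)
      fun w hw => ?_
    obtain ⟨k, hkT, hkK, hkp⟩ := horb h hpos hh0 w hw
    refine card_visitSet_ge hW2 hWM hp hpos hh8 (k := k) ?_ ?_ (hZ w hw).1 (hZ w hw).2 hkK hkp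
    · rw [hm, Nat.lt_succ_iff]
      exact Nat.le_floor ((le_div_iff₀ hpos).2 hkT)
    · intro j hj
      rw [hJ] at hj
      exact (le_div_iff₀ hhM).1 (Nat.lt_ceil.1 hj).le
  have hexp : ∀ k ∈ Finset.range m, volume (visitSet (eulerStep W h) K r p k) ≤
      2 * volume ((eulerStep W h)^[k] '' visitSet (eulerStep W h) K r p k) := by
    intro k hk
    refine volume_visitSet_le hWm hKm hL hC hW htr hdet hpos hhL hhC ?_
    have h1 : (k : ℝ) ≤ T / h := by
      rw [hm] at hk
      exact (Nat.le_floor_iff (div_nonneg hT hpos.le)).1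
        (Nat.lt_succ_iff.1 (Finset.mem_range.1 hk))
    exact (le_div_iff₀ hpos).1 h1
  have hup : ∑ k ∈ Finset.range m, volume ((eulerStep W h)^[k] '' visitSet (eulerStep W h) K r p k)
      ≤ N * volume (Metric.ball p 4) := by
    refine sum_measure_le_of_card_le volume m N
      (fun k => measurableSet_image_iterate hinj hc k (measurableSet_visitSet hFm hKm r p k)
        (fun w hw j hj => hw.2.1 j hj.le)) measurableSet_ball ?_
      (card_image_visitSet_le hW2 hin hr hD hpos hh8 hinj ?_)
    · rintro k _ ⟨w, hw, rfl⟩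
      exact hw.2.2
    · rw [hN]
      push_cast
      exact Nat.lt_floor_add_one _
  -- With `J ≥ 1 / (h * M)` and `N ≤ 7 * r / h` the step size cancels, leaving `2 * 7 * 16 * π * r *
  -- M`.
  have htot : J * volume Z ≤ 2 * (N * ENNReal.ofReal (16 * Real.pi)) := by
    refine (hlow.trans (Finset.sum_le_sum hexp)).trans ?_
    rw [← Finset.mul_sum]
    gcongr
    refine hup.trans_eq ?_
    rw [EuclideanSpace.volume_ball_fin_two]
    congr 1
    rw [← ENNReal.ofReal_pow (by norm_num), ← NNReal.coe_real_pi, ← ENNReal.ofReal_mul (by positivity)]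
    norm_num
  have hNle : (N : ℝ) ≤ 7 * r / h := by
    rw [hN, Nat.cast_add, Nat.cast_one]
    have h1 := Nat.floor_le (show 0 ≤ (4 * r + 2) / h by positivity)
    have h2 : (4 * r + 2) / h + 1 ≤ 7 * r / h := by
      rw [div_add_one hpos.ne']
      gcongr
      linarith
    linarith
  have hJge : ENNReal.ofReal (1 / (h * M)) ≤ J := by
    rw [← ENNReal.ofReal_natCast, hJ]
    exact ENNReal.ofReal_le_ofReal (Nat.le_ceil _)
  have hfin : ENNReal.ofReal (1 / (h * M)) * volume Z ≤
      ENNReal.ofReal (1 / (h * M)) * ENNReal.ofReal (224 * Real.pi * r * M) := by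
    refine (mul_le_mul_left hJge _).trans (htot.trans ?_)
    rw [← ENNReal.ofReal_mul (by positivity), ← ENNReal.ofReal_natCast,
      ← ENNReal.ofReal_mul (by positivity),
      show (2 : ENNReal) = ENNReal.ofReal 2 by simp, ← ENNReal.ofReal_mul (by positivity)]
    apply ENNReal.ofReal_le_ofReal
    calc 2 * ((N : ℝ) * (16 * Real.pi)) ≤ 2 * (7 * r / h * (16 * Real.pi)) := by gcongr
      _ = 1 / (h * M) * (224 * Real.pi * r * M) := by field_simp; norm_num
  refine (ENNReal.mul_le_mul_iff_right ?_ ENNReal.ofReal_ne_top).1 hfin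
  exact (ENNReal.ofReal_pos.2 (by positivity)).ne'

end GFA

/-! ### Shadowing of trajectories by Euler orbits -/

namespace GFA

theorem norm_sub_sub_smul_le {E : Type*} [NormedAddCommGroup E] [NormedSpace ℝ E] {V : E → E}
    {K : Set E} {L : NNReal} {B T : ℝ} (hLV : LipschitzOnWith L V K) (hB : ∀ y ∈ K, ‖V y‖ ≤ B)
    {γ : ℝ → E} (hγ : ∀ t ∈ Set.Icc 0 T, HasDerivWithinAt γ (V (γ t)) (Set.Icc 0 T) t)
    (hK : ∀ t ∈ Set.Icc 0 T, γ t ∈ K) {t d : ℝ} (ht : 0 ≤ t) (hd : 0 ≤ d) (htd : t + d ≤ T) :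
    ‖γ (t + d) - γ t‖ ≤ B * d ∧ ‖γ (t + d) - γ t - d • V (γ t)‖ ≤ L * B * d * d := by
  have hsub : Set.Icc t (t + d) ⊆ Set.Icc 0 T := Set.Icc_subset_Icc ht htd
  have hγ' : ∀ s ∈ Set.Icc t (t + d), HasDerivWithinAt γ (V (γ s)) (Set.Icc t (t + d)) s :=
    fun s hs => (hγ s (hsub hs)).mono hsub
  have h1 : ∀ s ∈ Set.Icc t (t + d), ‖γ s - γ t‖ ≤ B * (s - t) := by
    intro s hs
    have := (convex_Icc t (t + d)).norm_image_sub_le_of_norm_hasDerivWithin_le (C := B)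
      hγ' (fun u hu => hB _ (hK u (hsub hu))) (Set.left_mem_Icc.2 (by linarith)) hs
    rwa [Real.norm_of_nonneg (by linarith [hs.1])] at this
  have hmem : t + d ∈ Set.Icc t (t + d) := Set.right_mem_Icc.2 (by linarith)
  have hmem' : t ∈ Set.Icc t (t + d) := Set.left_mem_Icc.2 (by linarith)
  refine ⟨by simpa using h1 _ hmem, ?_⟩
  have h2 := (convex_Icc t (t + d)).norm_image_sub_le_of_norm_hasDerivWithin_le
    (f := fun s => γ s - s • V (γ t)) (f' := fun s => V (γ s) - (1 : ℝ) • V (γ t))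
    (C := L * B * d) (fun s hs => (hγ' s hs).sub ((hasDerivWithinAt_id s _).smul_const (V (γ t))))
    (fun s hs => by
      have h3 := hLV.dist_le_mul _ (hK s (hsub hs)) _ (hK t (hsub hmem'))
      rw [dist_eq_norm, dist_eq_norm] at h3
      have hB0 : 0 ≤ B := (norm_nonneg _).trans (hB _ (hK s (hsub hs)))
      rw [one_smul]
      refine h3.trans ?_
      rw [mul_assoc]
      gcongr
      exact (h1 s hs).trans (by gcongr; linarith [hs.2])) hmem' hmem
  have e : γ (t + d) - (t + d) • V (γ t) - (γ t - t • V (γ t)) = γ (t + d) - γ t - d • V (γ t) := by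
    rw [add_smul]; abel
  rw [e] at h2
  refine h2.trans_eq ?_
  simp [abs_of_nonneg hd]

/-- Trajectories of `V = g • W` are shadowed by the Euler orbits of `W`, up to a change of time. -/
theorem exists_eulerStep_shadow {E : Type*} [NormedAddCommGroup E] [NormedSpace ℝ E]
    {W V : E → E} {g : E → ℝ} {K K' : Set E} {L : NNReal} (hLW : LipschitzOnWith L W K)
    (hLV : LipschitzOnWith L V K) (hV : ∀ y ∈ K, V y = g y • W y) {c₁ c₂ B δ T₀ : ℝ} (hc₁ : 0 < c₁)
    (hg₁ : ∀ y ∈ K, c₁ ≤ g y) (hg₂ : ∀ y ∈ K, g y ≤ c₂) (hc₂ : 0 ≤ c₂) (hB0 : 0 ≤ B)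
    (hB : ∀ y ∈ K, ‖V y‖ ≤ B)
    (hδ : 0 < δ) (hT₀ : 0 ≤ T₀) (hKK : ∀ y ∈ K', ∀ z, dist z y ≤ δ → z ∈ K) :
    ∃ h₀ > 0, ∀ h, 0 < h → h < h₀ → ∀ (T : ℝ) (γ : ℝ → E), 0 ≤ T → T ≤ T₀ →
      (∀ t ∈ Set.Icc 0 T, HasDerivWithinAt γ (V (γ t)) (Set.Icc 0 T) t) →
      (∀ t ∈ Set.Icc 0 T, γ t ∈ K') →
      ∃ k : ℕ, k * h ≤ c₂ * T₀ ∧ (∀ j ≤ k, (eulerStep W h)^[j] (γ 0) ∈ K) ∧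
        dist ((eulerStep W h)^[k] (γ 0)) (γ T) ≤ δ := by
  set C : ℝ := L * B * (1 / c₁) * (1 / c₁) with hC
  have hC0 : 0 ≤ C := by positivity
  -- Each step adds an error of at most `C * h ^ 2`. Accumulated as in Grönwall's inequality over
  -- the `W`-time `c₂ * T₀`, this is at most `h * G`.
  set G : ℝ := C * (c₂ * T₀ * Real.exp (c₂ * T₀ * L)) with hG
  have hG0 : 0 ≤ G := by positivity
  refine ⟨δ / (2 * (G + B / c₁ + 1)), by positivity, fun h hpos hh T γ hT0 hTT hγ hγK => ?_⟩
  have hK'K : K' ⊆ K := fun y hy => hKK y hy y (by simpa using hδ.le)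
  have hsmall : h * (G + B / c₁) ≤ δ / 2 := by
    rw [lt_div_iff₀ (by positivity)] at hh
    nlinarith
  have hBc : 0 ≤ B / c₁ := by positivity
  have hs1 : h * G ≤ δ / 2 := by nlinarith
  have hs2 : h * (B / c₁) ≤ δ / 2 := by nlinarith
  set F := eulerStep W h with hF
  have herr : ∀ m : ℕ, m * h ≤ c₂ * T₀ → C * h ^ 2 * m * Real.exp (m * h * L) ≤ h * G := by
    intro m hm
    calc C * h ^ 2 * m * Real.exp (m * h * L)
        = h * (C * ((m * h) * Real.exp (m * h * L))) := by ring
      _ ≤ h * (C * ((c₂ * T₀) * Real.exp (c₂ * T₀ * L))) := by gcongr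
      _ = h * G := by rw [hG]
  -- If no Euler point comes close to `γ T`, the comparison below never runs past `T` and can be
  -- continued forever; but `m` steps use at least the time `m * h / c₂`, which is bounded by `T₀`.
  by_contra! hno
  have hstep : ∀ m : ℕ, ∃ t ∈ Set.Icc 0 T, m * h ≤ c₂ * t ∧ (∀ j ≤ m, F^[j] (γ 0) ∈ K) ∧
      ‖F^[m] (γ 0) - γ t‖ ≤ C * h ^ 2 * m * Real.exp (m * h * L) := by
    intro m
    induction m with
    | zero =>
      refine ⟨0, Set.left_mem_Icc.2 hT0, by simp, fun j hj => ?_, by simp⟩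
      obtain rfl : j = 0 := by omega
      exact hK'K (hγK 0 (Set.left_mem_Icc.2 hT0))
    | succ m ih =>
      obtain ⟨t, ht, hmt, hmK, hme⟩ := ih
      have hpK : γ t ∈ K := hK'K (hγK t ht)
      have hm : m * h ≤ c₂ * T₀ := hmt.trans (by gcongr; exact ht.2.trans hTT)
      have hgpos : 0 < g (γ t) := hc₁.trans_le (hg₁ _ hpK)
      -- The time along `V = g • W` that corresponds, to first order, to one step of length `h`
      -- along `W`.
      set d : ℝ := h / g (γ t) with hd
      have hdpos : 0 < d := by positivity
      have hdle : d ≤ h * (1 / c₁) := by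
        rw [hd, div_eq_mul_one_div]
        gcongr
        exact hg₁ _ hpK
      have hmδ := hme.trans ((herr m hm).trans hs1)
      rcases lt_or_ge T (t + d) with htd | htd
      · exfalso
        refine absurd (hno m hm hmK) (not_lt.2 ?_)
        have h1 := (norm_sub_sub_smul_le hLV hB hγ (fun t ht => hK'K (hγK t ht)) (t := t)
          (d := T - t) ht.1 (by linarith [ht.2]) (by linarith)).1
        rw [add_sub_cancel] at h1
        have h2 : B * (T - t) ≤ h * (B / c₁) := by
          calc B * (T - t) ≤ B * (h * (1 / c₁)) := by gcongr; linarith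
            _ = _ := by ring
        calc dist (F^[m] (γ 0)) (γ T) ≤ dist (F^[m] (γ 0)) (γ t) + dist (γ t) (γ T) :=
              dist_triangle _ _ _
          _ = ‖F^[m] (γ 0) - γ t‖ + ‖γ T - γ t‖ := by
              rw [dist_eq_norm, dist_comm, dist_eq_norm]
          _ ≤ δ := by linarith
      · have htd0 : t + d ∈ Set.Icc 0 T := ⟨by linarith [ht.1], htd⟩
        have hmt' : ((m + 1 : ℕ) : ℝ) * h ≤ c₂ * (t + d) := by
          have h1 : h ≤ c₂ * d := by
            calc h = g (γ t) * d := by rw [hd]; field_simp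
              _ ≤ c₂ * d := by gcongr; exact hg₂ _ hpK
          push_cast
          linarith
        have hm' : ((m + 1 : ℕ) : ℝ) * h ≤ c₂ * T₀ :=
          hmt'.trans (by gcongr; exact htd.trans hTT)
        have he : ‖F^[m + 1] (γ 0) - γ (t + d)‖ ≤
            C * h ^ 2 * (m + 1 : ℕ) * Real.exp ((m + 1 : ℕ) * h * L) := by
          rw [Function.iterate_succ_apply']
          set q := F^[m] (γ 0) with hq
          have hqK : q ∈ K := hmK m le_rfl
          have h1 := (norm_sub_sub_smul_le hLV hB hγ (fun t ht => hK'K (hγK t ht)) (t := t)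
            (d := d) ht.1 hdpos.le htd).2
          have h2 : d • V (γ t) = h • W (γ t) := by
            rw [hV _ hpK, smul_smul, hd, div_mul_cancel₀ _ hgpos.ne']
          have h3 : F q - γ (t + d) = (q - γ t) + h • (W q - W (γ t)) -
              (γ (t + d) - γ t - d • V (γ t)) := by
            rw [h2, hF, eulerStep, smul_sub]; abel
          have h4 : ‖W q - W (γ t)‖ ≤ L * ‖q - γ t‖ := by
            have := hLW.dist_le_mul _ hqK _ hpK
            rwa [dist_eq_norm, dist_eq_norm] at this
          have h5 : (L : ℝ) * B * d * d ≤ C * h ^ 2 := by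
            calc (L : ℝ) * B * d * d ≤ L * B * (h * (1 / c₁)) * (h * (1 / c₁)) := by gcongr
              _ = C * h ^ 2 := by rw [hC]; ring
          have h6 : 1 + h * L ≤ Real.exp (h * L) := by linarith [Real.add_one_le_exp (h * L)]
          have h7 : 1 ≤ Real.exp ((m + 1 : ℕ) * h * L) := Real.one_le_exp (by positivity)
          calc ‖F q - γ (t + d)‖
              ≤ ‖q - γ t‖ + h * (L * ‖q - γ t‖) + C * h ^ 2 := by
                rw [h3]
                refine (norm_sub_le _ _).trans ?_
                refine add_le_add ((norm_add_le _ _).trans ?_) (h1.trans h5)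
                rw [norm_smul, Real.norm_of_nonneg hpos.le]
                gcongr
            _ = (1 + h * L) * ‖q - γ t‖ + C * h ^ 2 * 1 := by ring
            _ ≤ Real.exp (h * L) * (C * h ^ 2 * m * Real.exp (m * h * L)) +
                C * h ^ 2 * Real.exp ((m + 1 : ℕ) * h * L) := by gcongr
            _ = C * h ^ 2 * (m + 1 : ℕ) * Real.exp ((m + 1 : ℕ) * h * L) := by
                have : Real.exp ((m + 1 : ℕ) * h * L) =
                    Real.exp (h * L) * Real.exp (m * h * L) := by
                  rw [← Real.exp_add]; congr 1; push_cast; ring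
                rw [this]; push_cast; ring
        refine ⟨t + d, htd0, hmt', fun j hj => ?_, he⟩
        rcases Nat.lt_or_ge j (m + 1) with hj' | hj'
        · exact hmK j (by omega)
        · obtain rfl : j = m + 1 := by omega
          refine hKK _ (hγK _ htd0) _ ?_
          rw [dist_eq_norm]
          exact he.trans ((herr _ hm').trans (hs1.trans (by linarith)))
  obtain ⟨m, hm⟩ := exists_nat_gt (c₂ * T₀ / h)
  obtain ⟨t, ht, hmt, -⟩ := hstep m
  have h1 : c₂ * t ≤ c₂ * T₀ := by gcongr; exact ht.2.trans hTT
  rw [div_lt_iff₀ hpos] at hm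
  linarith

end GFA

/-! ### The force and its normalization -/

namespace GFA

variable {n : ℕ}

/-- The sum `∑ ‖y - x i‖ ^ (-α)`, also for `α = 0`. -/
noncomputable def riesz (α : ℝ) (x : Fin n → Plane) (y : Plane) : ℝ := ∑ i, ‖y - x i‖ ^ (-α)

/-- The attractive force `∑ ‖y - x i‖ ^ (-α - 2) • (x i - y)`. -/
noncomputable def pull (α : ℝ) (x : Fin n → Plane) (y : Plane) : Plane :=
  ∑ i, ‖y - x i‖ ^ (-α - 2) • (x i - y)

/-- The force divided by the sum `riesz α x`; for `α ≠ 0`, this is `α⁻¹ • ∇ log E`. -/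
noncomputable def drift (α : ℝ) (x : Fin n → Plane) (y : Plane) : Plane :=
  (riesz α x y)⁻¹ • pull α x y

theorem norm_sub_pos_of_notMem {x : Fin n → Plane} {y : Plane} (hy : y ∉ Set.range x) (i : Fin n) :
    0 < ‖y - x i‖ :=
  norm_pos_iff.2 (sub_ne_zero.2 fun h => hy ⟨i, h.symm⟩)

theorem hasFDerivAt_norm_sub_rpow {y a : Plane} (h : 0 < ‖y - a‖) (p : ℝ) :
    HasFDerivAt (fun y => ‖y - a‖ ^ p) ((p * ‖y - a‖ ^ (p - 2)) • innerSL ℝ (y - a)) y := by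
  have h1 : HasFDerivAt (fun y : Plane => ‖y - a‖ ^ 2) (2 • innerSL ℝ (y - a)) y := by
    exact ((hasStrictFDerivAt_norm_sq (y - a)).hasFDerivAt.comp y
      ((hasFDerivAt_id y).sub_const a)).congr_fderiv (ContinuousLinearMap.comp_id _)
  have h2 := h1.rpow_const (p := p / 2) (Or.inl (pow_pos h 2).ne')
  have e : ∀ z : Plane, (‖z - a‖ ^ 2) ^ (p / 2) = ‖z - a‖ ^ p := fun z => by
    rw [← Real.rpow_natCast, ← Real.rpow_mul (norm_nonneg _)]; congr 1; push_cast; ring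
  simp only [e] at h2
  refine h2.congr_fderiv ?_
  rw [← Real.rpow_natCast ‖y - a‖ 2, ← Real.rpow_mul (norm_nonneg _), ← Nat.cast_smul_eq_nsmul ℝ,
    smul_smul]
  rw [show ((2 : ℕ) : ℝ) * (p / 2 - 1) = p - 2 by push_cast; ring,
    show p / 2 * ‖y - a‖ ^ (p - 2) * (2 : ℕ) = p * ‖y - a‖ ^ (p - 2) by push_cast; ring]

theorem norm_rpow_mul_sq {r : ℝ} (hr : 0 < r) (α : ℝ) : r ^ (-α - 2) * r ^ 2 = r ^ (-α) := by
  rw [← Real.rpow_natCast, ← Real.rpow_add hr]; congr 1; push_cast; ring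

theorem norm_rpow_mul_self {r : ℝ} (hr : 0 < r) (α : ℝ) : r ^ (-α - 2) * r = r ^ (-α - 1) := by
  nth_rw 2 [← Real.rpow_one r]
  rw [← Real.rpow_add hr]; congr 1; ring

theorem hasFDerivAt_riesz (α : ℝ) {x : Fin n → Plane} {y : Plane} (hy : y ∉ Set.range x) :
    HasFDerivAt (riesz α x) (α • innerSL ℝ (pull α x y)) y := by
  have h := HasFDerivAt.fun_sum (u := Finset.univ) fun i _ =>
    hasFDerivAt_norm_sub_rpow (norm_sub_pos_of_notMem hy i) (-α)
  refine h.congr_fderiv ?_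
  rw [pull, map_sum, Finset.smul_sum]
  refine Finset.sum_congr rfl fun i _ => ?_
  rw [map_smul, ← neg_sub y (x i), map_neg, smul_neg, smul_neg, smul_smul, neg_mul, neg_smul]

/-- The constant relating the gradient of the energy to the force. -/
noncomputable def forceConst (α : ℝ) : ℝ := if α = 0 then 1 else α

theorem forceConst_pos {α : ℝ} (h : 0 ≤ α) : 0 < forceConst α := by
  unfold forceConst; split_ifs with h0
  · exact one_pos
  · exact lt_of_le_of_ne h (Ne.symm h0)

theorem forceConst_le_one {α : ℝ} (h : α ≤ 1) : forceConst α ≤ 1 := by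
  unfold forceConst; split_ifs <;> simp [h]

theorem gradient_energy (α : ℝ) {x : Fin n → Plane} {y : Plane} (hy : y ∉ Set.range x) :
    gradient (energy α x) y = forceConst α • pull α x y := by
  apply HasGradientAt.gradient
  rw [hasGradientAt_iff_hasFDerivAt]
  unfold forceConst
  split_ifs with h0
  · subst h0
    have e : energy 0 x = fun y => ∑ i, -Real.log ‖y - x i‖ := by
      funext z; simp [energy]
    rw [e]
    have h := HasFDerivAt.fun_sum (u := Finset.univ) fun i _ =>
      ((hasFDerivAt_norm_sub_rpow (norm_sub_pos_of_notMem hy i) 1).log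
        (by rw [Real.rpow_one]; exact (norm_sub_pos_of_notMem hy i).ne')).fun_neg
    simp only [Real.rpow_one] at h
    refine h.congr_fderiv ?_
    rw [one_smul, pull, map_sum]
    refine Finset.sum_congr rfl fun i _ => ?_
    have hp := norm_sub_pos_of_notMem hy i
    rw [smul_smul, map_smul, ← neg_sub y (x i), map_neg, smul_neg]
    have e1 : ‖y - x i‖⁻¹ * (1 * ‖y - x i‖ ^ ((1 : ℝ) - 2)) = ‖y - x i‖ ^ (-(0 : ℝ) - 2) := by
      rw [one_mul, ← Real.rpow_neg_one, ← Real.rpow_add hp]; congr 1; norm_num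
    rw [e1]
    rfl
  · have e : energy α x = riesz α x := by
      funext z
      simp [energy, h0, riesz, Real.rpow_neg]
    rw [e]
    refine (hasFDerivAt_riesz α hy).congr_fderiv ?_
    rw [map_smul]
    rfl

/-- The derivative of the force. -/
noncomputable def pullDeriv (α : ℝ) (x : Fin n → Plane) (y : Plane) : Plane →L[ℝ] Plane :=
  ∑ i, (‖y - x i‖ ^ (-α - 2) • (-ContinuousLinearMap.id ℝ Plane) +
    (((-α - 2) * ‖y - x i‖ ^ (-α - 2 - 2)) • innerSL ℝ (y - x i)).smulRight (x i - y))

theorem hasFDerivAt_pull (α : ℝ) {x : Fin n → Plane} {y : Plane} (hy : y ∉ Set.range x) :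
    HasFDerivAt (pull α x) (pullDeriv α x y) y :=
  HasFDerivAt.fun_sum (u := Finset.univ) fun i _ =>
    (hasFDerivAt_norm_sub_rpow (norm_sub_pos_of_notMem hy i) (-α - 2)).smul
      ((hasFDerivAt_id y).const_sub (x i))

theorem trace_pullDeriv (α : ℝ) {x : Fin n → Plane} {y : Plane} (hy : y ∉ Set.range x) :
    LinearMap.trace ℝ Plane (pullDeriv α x y) = α * ∑ i, ‖y - x i‖ ^ (-α - 2) := by
  have e : (pullDeriv α x y : Plane →ₗ[ℝ] Plane) =
      ∑ i, (‖y - x i‖ ^ (-α - 2) • (-LinearMap.id) +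
        (((-α - 2) * ‖y - x i‖ ^ (-α - 2 - 2)) • (innerSL ℝ (y - x i) : Plane →ₗ[ℝ] ℝ)).smulRight
          (x i - y)) := by
    ext1 v
    simp [pullDeriv]
  rw [e, map_sum, Finset.mul_sum]
  refine Finset.sum_congr rfl fun i _ => ?_
  have hp := norm_sub_pos_of_notMem hy i
  rw [map_add, map_smul, map_neg, LinearMap.trace_id, LinearMap.trace_smulRight,
    finrank_euclideanSpace_fin, ← neg_sub y (x i), map_neg, LinearMap.smul_apply]
  simp only [ContinuousLinearMap.coe_coe, innerSL_apply_apply, real_inner_self_eq_norm_sq,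
    smul_eq_mul]
  have := norm_rpow_mul_sq hp (α + 2)
  rw [show -(α + 2) - 2 = -α - 2 - 2 by ring, show -(α + 2) = -α - 2 by ring] at this
  rw [← this]
  push_cast
  ring

theorem riesz_pos (α : ℝ) [NeZero n] {x : Fin n → Plane} {y : Plane} (hy : y ∉ Set.range x) :
    0 < riesz α x y :=
  Finset.sum_pos (fun i _ => Real.rpow_pos_of_pos (norm_sub_pos_of_notMem hy i) _)
    ⟨0, Finset.mem_univ _⟩

theorem norm_pull_le (α : ℝ) {x : Fin n → Plane} {y : Plane} (hy : y ∉ Set.range x) :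
    ‖pull α x y‖ ≤ ∑ i, ‖y - x i‖ ^ (-α - 1) := by
  refine (norm_sum_le _ _).trans (Finset.sum_le_sum fun i _ => ?_)
  rw [norm_smul, norm_sub_rev (x i), Real.norm_of_nonneg (by positivity),
    norm_rpow_mul_self (norm_sub_pos_of_notMem hy i)]

theorem norm_pull_sq_le (α : ℝ) {x : Fin n → Plane} {y : Plane} (hy : y ∉ Set.range x) :
    ‖pull α x y‖ ^ 2 ≤ riesz α x y * ∑ i, ‖y - x i‖ ^ (-α - 2) := by
  calc ‖pull α x y‖ ^ 2 ≤ (∑ i, ‖y - x i‖ ^ (-α - 1)) ^ 2 := by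
        gcongr; exact norm_pull_le α hy
    _ ≤ _ := by
        refine Finset.sum_sq_le_sum_mul_sum_of_sq_le_mul _ (fun i _ => by positivity)
          (fun i _ => by positivity) fun i _ => ?_
        have hp := norm_sub_pos_of_notMem hy i
        rw [← Real.rpow_natCast, ← Real.rpow_mul hp.le, ← Real.rpow_add hp]
        apply le_of_eq; congr 1; push_cast; ring

theorem contDiffAt_norm_sub_rpow {y a : Plane} (h : 0 < ‖y - a‖) (p : ℝ) :
    ContDiffAt ℝ 1 (fun y => ‖y - a‖ ^ p) y :=
  ((contDiffAt_id.sub contDiffAt_const).norm ℝ (norm_pos_iff.1 h)).rpow_const_of_ne h.ne'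

theorem contDiffAt_riesz (α : ℝ) {x : Fin n → Plane} {y : Plane} (hy : y ∉ Set.range x) :
    ContDiffAt ℝ 1 (riesz α x) y :=
  ContDiffAt.sum fun i _ => contDiffAt_norm_sub_rpow (norm_sub_pos_of_notMem hy i) _

theorem contDiffAt_pull (α : ℝ) {x : Fin n → Plane} {y : Plane} (hy : y ∉ Set.range x) :
    ContDiffAt ℝ 1 (pull α x) y :=
  ContDiffAt.sum fun i _ => (contDiffAt_norm_sub_rpow (norm_sub_pos_of_notMem hy i) _).smul
    (contDiffAt_const.sub contDiffAt_id)

theorem contDiffAt_drift (α : ℝ) [NeZero n] {x : Fin n → Plane} {y : Plane}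
    (hy : y ∉ Set.range x) : ContDiffAt ℝ 1 (drift α x) y :=
  ((contDiffAt_riesz α hy).inv (riesz_pos α hy).ne').smul (contDiffAt_pull α hy)

/-- The quotient rule gives the divergence `α * (Q * S - ‖F‖ ^ 2) / Q ^ 2`, with `F` the force, `Q`
the Riesz sum and `S` the sum with exponent `-α - 2`; `norm_pull_sq_le` makes the bracket
nonnegative. This is why the force is divided by exactly `Q`. -/
theorem trace_fderiv_drift_nonneg {α : ℝ} (hα : 0 ≤ α) [NeZero n] {x : Fin n → Plane} {y : Plane}
    (hy : y ∉ Set.range x) : 0 ≤ LinearMap.trace ℝ Plane (fderiv ℝ (drift α x) y) := by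
  have hQ := riesz_pos α hy
  have h := ((hasDerivAt_inv hQ.ne').comp_hasFDerivAt y (hasFDerivAt_riesz α hy)).smul (hasFDerivAt_pull α hy)
  have h' : HasFDerivAt (drift α x) _ y := h
  rw [h'.fderiv]
  have e : ((riesz α x y)⁻¹ • pullDeriv α x y +
      (-(riesz α x y ^ 2)⁻¹ • α • innerSL ℝ (pull α x y)).smulRight (pull α x y) :
        Plane →L[ℝ] Plane).toLinearMap =
      (riesz α x y)⁻¹ • (pullDeriv α x y : Plane →ₗ[ℝ] Plane) +
      (-(riesz α x y ^ 2)⁻¹ • α • (innerSL ℝ (pull α x y) : Plane →ₗ[ℝ] ℝ)).smulRight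
        (pull α x y) := by
    ext1 v
    simp
  refine (?_ : 0 ≤ LinearMap.trace ℝ Plane ((riesz α x y)⁻¹ • pullDeriv α x y +
      (-(riesz α x y ^ 2)⁻¹ • α • innerSL ℝ (pull α x y)).smulRight (pull α x y) :
        Plane →L[ℝ] Plane).toLinearMap)
  rw [e, map_add, map_smul, trace_pullDeriv α hy, LinearMap.trace_smulRight]
  simp only [LinearMap.smul_apply, ContinuousLinearMap.coe_coe, innerSL_apply_apply,
    real_inner_self_eq_norm_sq, smul_eq_mul]
  have hc := norm_pull_sq_le α hy
  set Q := riesz α x y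
  set S := ∑ i, ‖y - x i‖ ^ (-α - 2)
  have : Q⁻¹ * (α * S) + -(Q ^ 2)⁻¹ * (α * ‖pull α x y‖ ^ 2) =
      α * (Q ^ 2)⁻¹ * (Q * S - ‖pull α x y‖ ^ 2) := by
    field_simp
    ring
  rw [this]
  have : 0 ≤ Q * S - ‖pull α x y‖ ^ 2 := sub_nonneg.2 hc
  positivity

theorem norm_drift_le (α : ℝ) [NeZero n] {x : Fin n → Plane} {y : Plane}
    (hy : y ∉ Set.range x) :
    ‖drift α x y‖ ≤ (∑ i, ‖y - x i‖ ^ (-α - 1)) / riesz α x y := by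
  rw [drift, norm_smul, norm_inv, Real.norm_of_nonneg (riesz_pos α hy).le, inv_mul_eq_div]
  have := riesz_pos α hy
  gcongr
  exact norm_pull_le α hy

theorem notMem_range_of_half_le {x : Fin n → Plane} {y : Plane} (hy : ∀ i, 1 / 2 ≤ dist y (x i)) :
    y ∉ Set.range x := by
  rintro ⟨i, rfl⟩
  have := hy i
  rw [dist_self] at this
  norm_num at this

theorem norm_drift_le_two (α : ℝ) [NeZero n] {x : Fin n → Plane} {y : Plane}
    (hy : ∀ i, 1 / 2 ≤ dist y (x i)) : ‖drift α x y‖ ≤ 2 := by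
  have hy' := notMem_range_of_half_le hy
  refine (norm_drift_le α hy').trans ?_
  rw [div_le_iff₀ (riesz_pos α hy'), riesz, Finset.mul_sum]
  refine Finset.sum_le_sum fun i _ => ?_
  have hp := norm_sub_pos_of_notMem hy' i
  have h1 : 1 / 2 ≤ ‖y - x i‖ := by rw [← dist_eq_norm]; exact hy i
  rw [Real.rpow_sub_one hp.ne', div_le_iff₀ hp]
  have := Real.rpow_pos_of_pos hp (-α)
  nlinarith

/-- Since `‖y - x i‖ ≥ 2 * D`, the position of `x i` changes the inner product by at most half of
`‖y - x i‖ ^ 2`. Weighted with `‖y - x i‖ ^ (-α - 2)`, this is half of the corresponding term of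
`Q`, so the normalized inward pull is bounded below independently of the configuration. -/
theorem inner_drift_le (α : ℝ) [NeZero n] {x : Fin n → Plane} {y : Plane} {D : ℝ}
    (hy : y ∉ Set.range x) (hx : ∀ i, ‖x i‖ ≤ D) (hD : 3 * D ≤ ‖y‖) :
    inner ℝ y (drift α x y) ≤ -(1 / 2) := by
  have hQ := riesz_pos α hy
  rw [drift, inner_smul_right, inv_mul_eq_div, div_le_iff₀ hQ, pull, inner_sum, riesz,
    Finset.mul_sum]
  refine Finset.sum_le_sum fun i _ => ?_
  have hp := norm_sub_pos_of_notMem hy i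
  rw [inner_smul_right, ← norm_rpow_mul_sq hp α]
  have h1 : inner ℝ y (x i - y) ≤ -(1 / 2) * ‖y - x i‖ ^ 2 := by
    have e : inner ℝ y (x i - y) = -‖y - x i‖ ^ 2 - inner ℝ (x i) (y - x i) := by
      rw [← real_inner_self_eq_norm_sq, ← neg_sub y (x i), inner_neg_right, inner_sub_left]
      ring
    have h2 := abs_real_inner_le_norm (x i) (y - x i)
    have h3 := (abs_le.1 h2).1
    have h4 := norm_sub_norm_le y (x i)
    have h5 := hx i
    rw [e]
    nlinarith
  have := Real.rpow_pos_of_pos hp (-α - 2)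
  nlinarith

theorem measurable_drift (α : ℝ) (x : Fin n → Plane) : Measurable (drift α x) := by
  have hr : ∀ (p : ℝ) (i : Fin n), Measurable fun y : Plane => ‖y - x i‖ ^ p := fun p i =>
    (measurable_id.sub_const (x i)).norm.pow_const p
  have h1 : Measurable (riesz α x) := Finset.measurable_fun_sum _ fun i _ => hr _ i
  have h2 : Measurable (pull α x) := Finset.measurable_fun_sum _ fun i _ =>
    (hr _ i).smul (measurable_id.const_sub (x i))
  exact h1.inv.smul h2

end GFA

/-! ### Area of the starting points that reach a given particle -/

namespace GFA

variable {n : ℕ}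

/-- The points of norm at most `R` at distance at least `1 / 2` from all particles. -/
def farSet (x : Fin n → Plane) (R : ℝ) : Set Plane :=
  {y | ‖y‖ ≤ R} ∩ {y | ∀ j, 1 / 2 ≤ dist y (x j)}

theorem isCompact_farSet (x : Fin n → Plane) (R : ℝ) : IsCompact (farSet x R) := by
  have h1 : IsCompact {y : Plane | ‖y‖ ≤ R} := by
    have : {y : Plane | ‖y‖ ≤ R} = Metric.closedBall 0 R := by ext; simp
    rw [this]
    exact isCompact_closedBall 0 R
  refine h1.inter_right ?_
  have : {y : Plane | ∀ j, 1 / 2 ≤ dist y (x j)} = ⋂ j, {y | 1 / 2 ≤ dist y (x j)} := by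
    ext; simp
  rw [this]
  exact isClosed_iInter fun j => isClosed_le continuous_const (continuous_id.dist continuous_const)

theorem exists_lipschitzOnWith_of_contDiffAt {E F : Type*} [NormedAddCommGroup E]
    [NormedSpace ℝ E] [NormedAddCommGroup F] [NormedSpace ℝ F] {f : E → F} {K : Set E}
    (hK : IsCompact K) (hf : ∀ y ∈ K, ContDiffAt ℝ 1 f y) : ∃ L, LipschitzOnWith L f K := by
  refine LocallyLipschitzOn.exists_lipschitzOnWith_of_compact hK fun y hy => ?_
  obtain ⟨L, t, ht, hL⟩ := (hf y hy).exists_lipschitzOnWith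
  exact ⟨L, t, mem_nhdsWithin_of_mem_nhds ht, hL⟩

theorem exists_det_fderiv_drift_bound (α : ℝ) [NeZero n] (x : Fin n → Plane) (R : ℝ) :
    ∃ C, 0 ≤ C ∧ ∀ y ∈ farSet x R, |(fderiv ℝ (drift α x) y).det| ≤ C := by
  have hc : ContinuousOn (fun y => (fderiv ℝ (drift α x) y).det) (farSet x R) := fun y hy =>
    (ContinuousLinearMap.continuous_det.continuousAt.comp
      ((contDiffAt_drift α (notMem_range_of_half_le hy.2)).continuousAt_fderiv
        one_ne_zero)).continuousWithinAt
  obtain ⟨C, hC⟩ := (isCompact_farSet x R).exists_bound_of_continuousOn hc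
  exact ⟨max C 0, le_max_right _ _, fun y hy => (hC y hy).trans (le_max_left _ _)⟩

theorem exists_riesz_bounds (α : ℝ) [NeZero n] (x : Fin n → Plane) (R : ℝ) :
    ∃ c₁ c₂, 0 < c₁ ∧ 0 ≤ c₂ ∧ ∀ y ∈ farSet x R, c₁ ≤ riesz α x y ∧ riesz α x y ≤ c₂ := by
  have hc : ContinuousOn (riesz α x) (farSet x R) := fun y hy =>
    (contDiffAt_riesz α (notMem_range_of_half_le hy.2)).continuousAt.continuousWithinAt
  have hpos : ∀ y ∈ farSet x R, 0 < riesz α x y := fun y hy =>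
    riesz_pos α (notMem_range_of_half_le hy.2)
  obtain ⟨C, hC⟩ := (isCompact_farSet x R).exists_bound_of_continuousOn hc
  obtain ⟨C', hC'⟩ := (isCompact_farSet x R).exists_bound_of_continuousOn
    (hc.inv₀ fun y hy => (hpos y hy).ne')
  refine ⟨(max C' 0 + 1)⁻¹, max C 0, by positivity, le_max_right _ _, fun y hy => ⟨?_, ?_⟩⟩
  · have h1 := hC' y hy
    rw [Pi.inv_apply, norm_inv, Real.norm_of_nonneg (hpos y hy).le] at h1
    rw [inv_le_comm₀ (by positivity) (hpos y hy)]
    linarith [le_max_left C' 0]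
  · exact ((le_abs_self _).trans (hC y hy)).trans (le_max_left _ _)

theorem norm_gradient_energy_le {α : ℝ} (h0 : 0 ≤ α) (h1 : α ≤ 1) {x : Fin n → Plane} {y : Plane}
    (hy : ∀ j, 1 / 2 ≤ dist y (x j)) : ‖gradient (energy α x) y‖ ≤ n * 4 := by
  have hy' := notMem_range_of_half_le hy
  rw [gradient_energy α hy', norm_smul, Real.norm_of_nonneg (forceConst_pos h0).le]
  have h2 : ‖pull α x y‖ ≤ n * 4 := by
    refine (norm_pull_le α hy').trans ?_
    calc ∑ i, ‖y - x i‖ ^ (-α - 1) ≤ ∑ _i : Fin n, (4 : ℝ) := by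
          refine Finset.sum_le_sum fun i _ => ?_
          have h3 : 1 / 2 ≤ ‖y - x i‖ := by rw [← dist_eq_norm]; exact hy i
          calc ‖y - x i‖ ^ (-α - 1) ≤ (1 / 2 : ℝ) ^ (-α - 1) :=
                Real.rpow_le_rpow_of_nonpos (by norm_num) h3 (by linarith)
            _ ≤ (1 / 2 : ℝ) ^ (-2 : ℝ) :=
                Real.rpow_le_rpow_of_exponent_ge (by norm_num) (by norm_num) (by linarith)
            _ = 4 := by
                rw [Real.rpow_neg (by norm_num)]; norm_num
      _ = n * 4 := by simp
  calc forceConst α * ‖pull α x y‖ ≤ 1 * ‖pull α x y‖ := by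
        gcongr; exact forceConst_le_one h1
    _ ≤ _ := by rwa [one_mul]

/-- The points of the annulus `r ≤ ‖w‖ ≤ r + 1` from which the gradient flow, staying at distance
at least `1` from all particles, gets within distance `2` of the particle `x i` at a time
`T ≤ T₀`. -/
def reachSet (α : ℝ) (x : Fin n → Plane) (i : Fin n) (r T₀ : ℝ) : Set Plane :=
  {w | (r ≤ ‖w‖ ∧ ‖w‖ ≤ r + 1) ∧ ∃ (T : ℝ) (γ : ℝ → Plane), 0 ≤ T ∧ T ≤ T₀ ∧ γ 0 = w ∧
    dist (γ T) (x i) ≤ 2 ∧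
    (∀ t ∈ Set.Icc 0 T, HasDerivWithinAt γ (gradient (energy α x) (γ t)) (Set.Icc 0 T) t) ∧
    ∀ t ∈ Set.Icc 0 T, ∀ j, 1 ≤ dist (γ t) (x j)}

theorem volume_reachSet_le {α : ℝ} (h0 : 0 ≤ α) (h1 : α ≤ 1) [NeZero n] {x : Fin n → Plane}
    {i : Fin n} {M D r T₀ : ℝ} (hM : 0 < M)
    (hMb : ∀ y, (∀ j, 1 / 2 ≤ dist y (x j)) → dist y (x i) ≤ 5 → ‖drift α x y‖ ≤ M)
    (hD : 0 ≤ D) (hx : ∀ j, ‖x j‖ ≤ D) (hr : 3 * D + 4 ≤ r) (hT₀ : 0 ≤ T₀) :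
    volume (reachSet α x i r T₀) ≤ ENNReal.ofReal (224 * Real.pi * r * M) := by
  -- The speed is at most `4 * n`, so trajectories stay within norm `r + 1 + 4 * n * T₀`; the last
  -- `1` leaves room for the shadowing error `1 / 2`.
  set R : ℝ := r + 1 + n * 4 * T₀ + 1 with hR
  have hK := isCompact_farSet x R
  obtain ⟨L₁, hL₁⟩ := exists_lipschitzOnWith_of_contDiffAt hK fun y hy =>
    contDiffAt_drift α (notMem_range_of_half_le hy.2)
  obtain ⟨L₂, hL₂'⟩ := exists_lipschitzOnWith_of_contDiffAt hK fun y hy =>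
    (contDiffAt_pull α (notMem_range_of_half_le hy.2)).const_smul (forceConst α)
  have hL₂ : LipschitzOnWith L₂ (gradient (energy α x)) (farSet x R) := fun y hy z hz => by
    rw [gradient_energy α (notMem_range_of_half_le hy.2),
      gradient_energy α (notMem_range_of_half_le hz.2)]
    exact hL₂' hy hz
  obtain ⟨C, hC0, hC⟩ := exists_det_fderiv_drift_bound α x R
  obtain ⟨c₁, c₂, hc₁, hc₂, hc⟩ := exists_riesz_bounds α x R
  have hκ := forceConst_pos h0
  obtain ⟨h₀, h₀pos, hshadow⟩ := exists_eulerStep_shadow (W := drift α x)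
    (V := gradient (energy α x)) (g := fun y => forceConst α * riesz α x y) (K := farSet x R)
    (K' := {y | ‖y‖ ≤ R - 1} ∩ {y | ∀ j, 1 ≤ dist y (x j)}) (L := max L₁ L₂)
    (hL₁.weaken (le_max_left _ _)) (hL₂.weaken (le_max_right _ _))
    (fun y hy => by
      have := riesz_pos α (notMem_range_of_half_le hy.2)
      rw [gradient_energy α (notMem_range_of_half_le hy.2), drift, smul_smul, mul_assoc,
        mul_inv_cancel₀ this.ne', mul_one])
    (c₁ := forceConst α * c₁) (c₂ := forceConst α * c₂) (B := n * 4) (δ := 1 / 2) (T₀ := T₀)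
    (by positivity) (fun y hy => by have := (hc y hy).1; gcongr)
    (fun y hy => by have := (hc y hy).2; gcongr) (by positivity)
    (by positivity) (fun y hy => norm_gradient_energy_le h0 h1 hy.2) (by norm_num) hT₀
    (fun y hy z hz => by
      refine ⟨?_, fun j => ?_⟩
      · have h2 : ‖y‖ ≤ R - 1 := hy.1
        have h3 := norm_sub_norm_le z y
        rw [← dist_eq_norm] at h3
        change ‖z‖ ≤ R
        linarith
      · have h2 : 1 ≤ dist y (x j) := hy.2 j
        have h3 := dist_triangle y z (x j)
        rw [dist_comm y z] at h3
        linarith)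
  refine volume_le_of_iterate_eulerStep_mem_ball (W := drift α x) (K := farSet x R)
    (p := x i) (D := 3 * D) (T := forceConst α * c₂ * T₀) (measurable_drift α x) hK.measurableSet
    hL₁ hC0
    (fun y hy => ((contDiffAt_drift α (notMem_range_of_half_le hy.2)).differentiableAt
      one_ne_zero).hasFDerivAt)
    (fun y hy => trace_fderiv_drift_nonneg h0 (notMem_range_of_half_le hy.2)) hC
    (fun y hy => norm_drift_le_two α hy.2)
    (fun y hy hyD => inner_drift_le α (notMem_range_of_half_le hy.2) hx hyD) (by linarith)
    (by positivity) hM (fun y hy hyp => hMb y hy.2 hyp) (by linarith [hx i])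
    (fun w hw => hw.1) (by positivity) h₀pos fun h hpos hh w hw => ?_
  obtain ⟨hw1, T, γ, hT, hTT, rfl, hend, hγ, hfar⟩ := hw
  obtain ⟨k, hk1, hk2, hk3⟩ := hshadow h hpos hh T γ hT hTT hγ fun t ht => by
    refine ⟨?_, hfar t ht⟩
    have h2 := (convex_Icc 0 T).norm_image_sub_le_of_norm_hasDerivWithin_le (C := n * 4) hγ
      (fun s hs => norm_gradient_energy_le h0 h1 fun j => by linarith [hfar s hs j])
      (Set.left_mem_Icc.2 hT) ht
    rw [sub_zero, Real.norm_of_nonneg ht.1] at h2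
    have h3 := norm_sub_norm_le (γ t) (γ 0)
    have h4 : (n : ℝ) * 4 * t ≤ n * 4 * T₀ := by gcongr; exact ht.2.trans hTT
    change ‖γ t‖ ≤ R - 1
    linarith [hw1.2]
  refine ⟨k, hk1, hk2, ?_⟩
  have := dist_triangle ((eulerStep (drift α x) h)^[k] (γ 0)) (γ T) (x i)
  linarith

/-- The same bound without a restriction on the time. -/
theorem volume_iUnion_reachSet_le {α : ℝ} (h0 : 0 ≤ α) (h1 : α ≤ 1) [NeZero n]
    {x : Fin n → Plane} {i : Fin n} {M D r : ℝ} (hM : 0 < M)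
    (hMb : ∀ y, (∀ j, 1 / 2 ≤ dist y (x j)) → dist y (x i) ≤ 5 → ‖drift α x y‖ ≤ M)
    (hD : 0 ≤ D) (hx : ∀ j, ‖x j‖ ≤ D) (hr : 3 * D + 4 ≤ r) :
    volume (⋃ N : ℕ, reachSet α x i r N) ≤ ENNReal.ofReal (224 * Real.pi * r * M) := by
  have hmono : Monotone fun N : ℕ => reachSet α x i r N := by
    rintro a b hab w ⟨hw, T, γ, hT, hTT, h⟩
    exact ⟨hw, T, γ, hT, hTT.trans (by exact_mod_cast hab), h⟩
  rw [hmono.measure_iUnion]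
  exact iSup_le fun N => volume_reachSet_le h0 h1 hM hMb hD hx hr N.cast_nonneg

end GFA

/-! ### From area in polar coordinates to attachment probabilities -/

namespace GFA

variable {n : ℕ}

theorem norm_circlePoint {s : ℝ} (hs : 0 ≤ s) (θ : ℝ) : ‖circlePoint s θ‖ = s := by
  have h : (s * Real.cos θ) ^ 2 + (s * Real.sin θ) ^ 2 = s ^ 2 := by
    linear_combination s ^ 2 * Real.cos_sq_add_sin_sq θ
  rw [EuclideanSpace.norm_eq, circlePoint]
  simp only [Fin.sum_univ_two, Real.norm_eq_abs, sq_abs]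
  exact (congrArg Real.sqrt h).trans (Real.sqrt_sq hs)

/-- The plane with its Euclidean structure, as a product. -/
noncomputable def planeEquiv : Plane ≃ᵐ ℝ × ℝ :=
  (MeasurableEquiv.toLp 2 (Fin 2 → ℝ)).symm.trans MeasurableEquiv.finTwoArrow

theorem planeEquiv_measurePreserving : MeasurePreserving planeEquiv :=
  (volume_preserving_finTwoArrow ℝ).comp
    (EuclideanSpace.volume_preserving_symm_measurableEquiv_toLp (Fin 2))

theorem planeEquiv_symm_polarCoord (s θ : ℝ) :
    planeEquiv.symm (polarCoord.symm (s, θ)) = circlePoint s θ := by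
  apply planeEquiv.injective
  rw [MeasurableEquiv.apply_symm_apply]
  rfl

theorem volume_Ioc_circlePoint {Z : Set Plane} (hZ : MeasurableSet Z) (s : ℝ) :
    volume ({θ | circlePoint s θ ∈ Z} ∩ Set.Ioc 0 (2 * Real.pi)) =
      volume ({θ | circlePoint s θ ∈ Z} ∩ Set.Ioo (-Real.pi) Real.pi) := by
  have hcont : Continuous (circlePoint s) := by
    unfold circlePoint
    fun_prop
  have h1 := isAddFundamentalDomain_Ioc Real.two_pi_pos 0
  have h2 := isAddFundamentalDomain_Ioc Real.two_pi_pos (-Real.pi)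
  rw [zero_add] at h1
  rw [show -Real.pi + 2 * Real.pi = Real.pi by ring] at h2
  have h3 : volume ({θ | circlePoint s θ ∈ Z} ∩ Set.Ioo (-Real.pi) Real.pi) =
      volume ({θ | circlePoint s θ ∈ Z} ∩ Set.Ioc (-Real.pi) Real.pi) :=
    measure_congr (ae_eq_set_inter (ae_eq_refl _) Ioo_ae_eq_Ioc)
  rw [h3]
  refine h1.measure_set_eq h2 (hcont.measurable hZ) fun g => ?_
  obtain ⟨_, k, rfl⟩ := g
  ext θ
  have : circlePoint s ((k • (2 * Real.pi) : ℝ) + θ) = circlePoint s θ := by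
    unfold circlePoint
    rw [add_comm, zsmul_eq_mul, Real.cos_add_int_mul_two_pi, Real.sin_add_int_mul_two_pi]
  change circlePoint s ((k • (2 * Real.pi) : ℝ) + θ) ∈ Z ↔ _
  rw [this]
  rfl

/-- Lower bound for the outer measure of a set, in polar coordinates. -/
theorem le_volume_of_le_volume_circlePoint {Z : Set Plane} {q : ENNReal} {r : ℝ} (hr : 0 < r)
    (hZ : ∀ s ∈ Set.Icc r (r + 1),
      q ≤ volume {θ : ℝ | θ ∈ Set.Ioc 0 (2 * Real.pi) ∧ circlePoint s θ ∈ Z}) :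
    ENNReal.ofReal r * q ≤ volume Z := by
  -- No measurability of `Z` is available, so polar coordinates are applied to a measurable hull of
  -- the same measure.
  set Z' := toMeasurable volume Z with hZ'
  have hm : MeasurableSet Z' := measurableSet_toMeasurable _ _
  have h1 : volume Z = ∫⁻ p : ℝ × ℝ, Z'.indicator 1 (planeEquiv.symm p) := by
    rw [planeEquiv_measurePreserving.symm.lintegral_comp (measurable_one.indicator hm),
      lintegral_indicator_one hm, hZ', measure_toMeasurable]
  have hmeas : Measurable fun p : ℝ × ℝ =>
      ENNReal.ofReal p.1 * Z'.indicator (1 : Plane → ENNReal) (circlePoint p.1 p.2) := by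
    have hcont : Continuous fun p : ℝ × ℝ => circlePoint p.1 p.2 := by
      unfold circlePoint
      fun_prop
    exact (ENNReal.measurable_ofReal.comp measurable_fst).mul
      ((measurable_one.indicator hm).comp hcont.measurable)
  rw [h1, ← lintegral_comp_polarCoord_symm, polarCoord_target]
  have h2 : ∀ p : ℝ × ℝ, ENNReal.ofReal p.1 •
      Z'.indicator (1 : Plane → ENNReal) (planeEquiv.symm (polarCoord.symm p)) =
      ENNReal.ofReal p.1 * Z'.indicator (1 : Plane → ENNReal) (circlePoint p.1 p.2) := fun p => by
    rw [← planeEquiv_symm_polarCoord, smul_eq_mul]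
  simp only [h2]
  calc ENNReal.ofReal r * q = ∫⁻ _s in Set.Ioc r (r + 1), ENNReal.ofReal r * q := by
        rw [setLIntegral_const, Real.volume_Ioc]; simp
    _ ≤ ∫⁻ s in Set.Ioc r (r + 1), ∫⁻ θ in Set.Ioo (-Real.pi) Real.pi,
          ENNReal.ofReal s * Z'.indicator 1 (circlePoint s θ) := by
        refine setLIntegral_mono' measurableSet_Ioc fun s hs => ?_
        have hcont : Continuous (circlePoint s) := by
          unfold circlePoint
          fun_prop
        have hms : MeasurableSet {θ | circlePoint s θ ∈ Z'} := hcont.measurable hm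
        have h3 : ∫⁻ θ in Set.Ioo (-Real.pi) Real.pi, Z'.indicator 1 (circlePoint s θ) =
            volume ({θ | circlePoint s θ ∈ Z'} ∩ Set.Ioo (-Real.pi) Real.pi) := by
          rw [← Measure.restrict_apply hms, ← lintegral_indicator_one hms]
          rfl
        have h6 : Measurable fun θ => Z'.indicator (1 : Plane → ENNReal) (circlePoint s θ) :=
          (measurable_one.indicator hm).comp hcont.measurable
        rw [lintegral_const_mul _ h6, h3,
          ← volume_Ioc_circlePoint hm]
        gcongr
        · exact hs.1.le
        · refine (hZ s ⟨hs.1.le, hs.2⟩).trans (measure_mono ?_)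
          rintro θ ⟨h4, h5⟩
          exact ⟨subset_toMeasurable _ _ h5, h4⟩
    _ = ∫⁻ p in Set.Ioc r (r + 1) ×ˢ Set.Ioo (-Real.pi) Real.pi,
          ENNReal.ofReal p.1 * Z'.indicator 1 (circlePoint p.1 p.2) := by
        rw [Measure.volume_eq_prod, setLIntegral_prod _ hmeas.aemeasurable]
    _ ≤ _ := by
        refine lintegral_mono_set ?_
        rintro ⟨s, θ⟩ ⟨h4, h5⟩
        exact ⟨hr.trans h4.1, h5⟩

/-- A particle coming from infinity stops near the particle `x i` with a probability controlled by
the size of the normalized force near `x i`. -/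
theorem IsLawFromInfinity.closedBall_le {α : ℝ} (h0 : 0 ≤ α) (h1 : α ≤ 1) [NeZero n]
    {x : Fin n → Plane} {ν : Measure Plane} (hν : IsLawFromInfinity α x ν) {i : Fin n} {M : ℝ}
    (hM : 0 < M)
    (hMb : ∀ y, (∀ j, 1 / 2 ≤ dist y (x j)) → dist y (x i) ≤ 5 → ‖drift α x y‖ ≤ M) :
    ν (Metric.closedBall (x i) 1) ≤ ENNReal.ofReal (112 * M) := by
  obtain ⟨hprob, hlim⟩ := hν
  -- Weak convergence applies only to sets with null boundary; all but countably many radii in `(1,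
  -- 2)` qualify.
  obtain ⟨ρ, hρ, hfr⟩ := exists_null_frontier_thickening ν {x i} (one_lt_two (α := ℝ))
  rw [Metric.thickening_singleton] at hfr
  have hlim := hlim _ measurableSet_ball hfr
  refine (measure_mono (Metric.closedBall_subset_ball hρ.1)).trans ?_
  refine le_of_forall_lt fun q hq => ?_
  obtain ⟨q', hqq', hq'⟩ := exists_between hq
  refine hqq'.trans_le ?_
  obtain ⟨r₀, hr₀⟩ := eventually_atTop.1 (hlim.eventually (lt_mem_nhds hq'))
  obtain ⟨D, hD⟩ : ∃ D, ∀ j, ‖x j‖ ≤ D :=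
    ⟨∑ j, ‖x j‖, fun j => Finset.single_le_sum (f := fun j => ‖x j‖) (fun _ _ => norm_nonneg _)
      (Finset.mem_univ j)⟩
  have hD0 : 0 ≤ D := (norm_nonneg _).trans (hD i)
  set r := max r₀ (3 * D + 4) with hr
  have hr4 : 3 * D + 4 ≤ r := le_max_right _ _
  have hrpos : 0 < r := by linarith
  have hup := volume_iUnion_reachSet_le h0 h1 hM hMb hD0 hD hr4
  have hlow := le_volume_of_le_volume_circlePoint (Z := ⋃ N : ℕ, reachSet α x i r N)
    (q := q' * ENNReal.ofReal (2 * Real.pi)) hrpos fun s hs => by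
      have h2 := hr₀ s ((le_max_left _ _).trans hs.1)
      rw [stopProb, ENNReal.lt_div_iff_mul_lt (Or.inl (by simp [Real.pi_pos]))
        (Or.inl ENNReal.ofReal_ne_top)] at h2
      refine h2.le.trans (measure_mono ?_)
      rintro θ ⟨hθ, y, hy, T, γ, hT, hγ0, hγT, hγ, hfar, hy1, -⟩
      refine ⟨hθ, Set.mem_iUnion.2 ⟨⌈T⌉₊, ?_, T, γ, hT, Nat.le_ceil T, hγ0, ?_, hγ, ?_⟩⟩
      · rw [norm_circlePoint (hrpos.le.trans hs.1)]
        exact hs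
      · rw [hγT]
        exact (Metric.mem_ball.1 hy).le.trans hρ.2.le
      · intro t ht j
        rcases ht.2.lt_or_eq with h | h
        · exact (hfar t ⟨ht.1, h⟩ j).le
        · rw [h, hγT]
          exact hy1 j
  have h3 := hlow.trans hup
  -- The circles contribute `2 * π * r` per unit of probability, which turns `224 * π * r * M` into
  -- `112 * M`.
  have h4 : ENNReal.ofReal (224 * Real.pi * r * M) =
      ENNReal.ofReal r * (ENNReal.ofReal (112 * M) * ENNReal.ofReal (2 * Real.pi)) := by
    rw [← ENNReal.ofReal_mul (by positivity), ← ENNReal.ofReal_mul hrpos.le]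
    congr 1
    ring
  rw [h4, ENNReal.mul_le_mul_iff_right (ENNReal.ofReal_pos.2 hrpos).ne' ENNReal.ofReal_ne_top,
    ENNReal.mul_le_mul_iff_left (ENNReal.ofReal_pos.2 Real.two_pi_pos).ne' ENNReal.ofReal_ne_top]
    at h3
  exact h3

/-- A particle coming from infinity almost surely stops at distance at least `1` from all
particles. -/
theorem IsLawFromInfinity.ae_stop {α : ℝ} {x : Fin n → Plane} {ν : Measure Plane}
    (hν : IsLawFromInfinity α x ν) :
    ∀ᵐ y ∂ν, (∀ j, 1 ≤ dist y (x j)) ∧ ∃ j, dist y (x j) = 1 := by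
  obtain ⟨hprob, hlim⟩ := hν
  set S : Set Plane := {y | (∀ j, 1 ≤ dist y (x j)) ∧ ∃ j, dist y (x j) = 1} with hS
  have hclosed : IsClosed S := by
    have h1 : S = (⋂ j, {y | 1 ≤ dist y (x j)}) ∩ ⋃ j, {y | dist y (x j) = 1} := by
      ext; simp [hS]
    rw [h1]
    exact (isClosed_iInter fun j => isClosed_le continuous_const
      (continuous_id.dist continuous_const)).inter (isClosed_iUnion_of_finite fun j =>
        isClosed_eq (continuous_id.dist continuous_const) continuous_const)
  change ν Sᶜ = 0
  -- Around each point outside the closed set `S` there is a ball with null boundary that misses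
  -- `S`. No flow stops in it, so its limiting mass vanishes.
  refine measure_null_of_locally_null _ fun y hy => ?_
  obtain ⟨ε, hε, hball⟩ := Metric.isOpen_iff.1 hclosed.isOpen_compl y hy
  obtain ⟨ρ, hρ, hfr⟩ := exists_null_frontier_thickening ν {y} hε
  rw [Metric.thickening_singleton] at hfr
  refine ⟨Metric.ball y ρ, mem_nhdsWithin_of_mem_nhds (Metric.ball_mem_nhds y hρ.1), ?_⟩
  have h1 := hlim _ measurableSet_ball hfr
  have h2 : (fun r => stopProb α x r (Metric.ball y ρ)) = fun _ => 0 := by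
    funext r
    have : {θ : ℝ | θ ∈ Set.Ioc 0 (2 * Real.pi) ∧
        ∃ z ∈ Metric.ball y ρ, FlowStopsAt α x (circlePoint r θ) z} = ∅ := by
      refine Set.eq_empty_of_forall_notMem ?_
      rintro θ ⟨-, z, hz, T, γ, -, -, -, -, -, h3, h4⟩
      exact hball (Metric.ball_subset_ball hρ.2.le hz) ⟨h3, h4⟩
    rw [stopProb, this, measure_empty, ENNReal.zero_div]
  rw [h2] at h1
  exact tendsto_nhds_unique h1 tendsto_const_nhds

end GFA

/-! ### Packing bounds and the Beurling estimate -/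

namespace GFA

/-- The discs of radius `1 / 2` around the points are disjoint and lie in a disc of radius `R + 1 /
2`; compare areas. -/
theorem card_le_of_one_le_dist {ι : Type*} (s : Finset ι) {x : ι → Plane} {y : Plane} {R : ℝ}
    (hx : ∀ i ∈ s, ∀ j ∈ s, i ≠ j → 1 ≤ dist (x i) (x j)) (hR : 0 ≤ R)
    (hy : ∀ i ∈ s, dist y (x i) ≤ R) : (s.card : ℝ) ≤ (2 * R + 1) ^ 2 := by
  have hdisj : (s : Set ι).PairwiseDisjoint fun i => Metric.ball (x i) (1 / 2) := by
    intro i hi j hj hij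
    refine Metric.ball_disjoint_ball ?_
    linarith [hx i hi j hj hij]
  have hsub : ⋃ i ∈ s, Metric.ball (x i) (1 / 2) ⊆ Metric.ball y (R + 1 / 2) := by
    refine Set.iUnion₂_subset fun i hi z hz => ?_
    rw [Metric.mem_ball] at hz ⊢
    have := dist_triangle z (x i) y
    have := hy i hi
    rw [dist_comm] at this
    linarith
  have h1 := measure_mono (μ := volume) hsub
  rw [measure_biUnion_finset hdisj fun _ _ => measurableSet_ball] at h1
  simp only [EuclideanSpace.volume_ball_fin_two, Finset.sum_const, nsmul_eq_mul] at h1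
  rw [← mul_assoc, ENNReal.mul_le_mul_iff_left (ENNReal.ofReal_pos.2 Real.pi_pos).ne' ENNReal.ofReal_ne_top,
    ← ENNReal.ofReal_pow (by norm_num), ← ENNReal.ofReal_pow (by positivity),
    ← ENNReal.ofReal_natCast, ← ENNReal.ofReal_mul (by positivity),
    ENNReal.ofReal_le_ofReal_iff (by positivity)] at h1
  nlinarith

theorem sum_succ_rpow_neg_le {σ : ℝ} (h0 : 0 ≤ σ) (h1 : σ < 1) (n : ℕ) :
    ∑ k ∈ Finset.range n, ((k : ℝ) + 1) ^ (-σ) ≤ (n : ℝ) ^ (1 - σ) / (1 - σ) := by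
  have hσ : 0 < 1 - σ := by linarith
  induction n with
  | zero => simp [Real.zero_rpow hσ.ne']
  | succ n ih =>
    rw [Finset.sum_range_succ]
    have hn : (0 : ℝ) < (n : ℝ) + 1 := by positivity
    have h2 : (n : ℝ) ^ (1 - σ) ≤ ((n : ℝ) + 1) ^ (1 - σ) - (1 - σ) * ((n : ℝ) + 1) ^ (-σ) := by
      have h3 := rpow_one_add_le_one_add_mul_self (s := -(1 / ((n : ℝ) + 1)))
        (by rw [neg_le_neg_iff, div_le_one hn]; linarith) hσ.le (by linarith : 1 - σ ≤ 1)
      have h4 : (n : ℝ) = (n + 1) * (1 + -(1 / ((n : ℝ) + 1))) := by field_simp; ring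
      have h5 : 0 ≤ 1 + -(1 / ((n : ℝ) + 1)) := by
        have : 1 / ((n : ℝ) + 1) ≤ 1 := by rw [div_le_one hn]; linarith
        linarith
      calc (n : ℝ) ^ (1 - σ) = ((n : ℝ) + 1) ^ (1 - σ) * (1 + -(1 / ((n : ℝ) + 1))) ^ (1 - σ) := by
            conv_lhs => rw [h4]
            rw [Real.mul_rpow hn.le h5]
        _ ≤ ((n : ℝ) + 1) ^ (1 - σ) * (1 + (1 - σ) * -(1 / ((n : ℝ) + 1))) := by gcongr
        _ = _ := by
            have : ((n : ℝ) + 1) ^ (-σ) = ((n : ℝ) + 1) ^ (1 - σ) / (n + 1) := by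
              rw [← Real.rpow_sub_one hn.ne']; congr 1; ring
            rw [this]
            field_simp
            ring
    push_cast
    rw [le_div_iff₀ hσ] at ih ⊢
    nlinarith

/-- Order the points by distance from `y`. By packing, the `k`-th distance `r` satisfies `k ≤ (2 * r
+ 1) ^ 2 ≤ (4 * r) ^ 2`, as `r ≥ 1 / 2`. The induction removes the farthest point. -/
theorem sum_dist_rpow_neg_le {ι : Type*} {β : ℝ} (hβ0 : 0 ≤ β) (hβ : β ≤ 2)
    (s : Finset ι) {x : ι → Plane} {y : Plane}
    (hx : ∀ i ∈ s, ∀ j ∈ s, i ≠ j → 1 ≤ dist (x i) (x j))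
    (hy : ∀ i ∈ s, 1 / 2 ≤ dist y (x i)) :
    ∑ i ∈ s, dist y (x i) ^ (-β) ≤ 16 * ∑ k ∈ Finset.range s.card, ((k : ℝ) + 1) ^ (-(β / 2)) := by
  classical
  induction s using Finset.induction_on_max_value (f := fun i => dist y (x i)) with
  | empty => simp
  | insert a s ha hmax ih =>
    rw [Finset.sum_insert ha, Finset.card_insert_of_notMem ha, Finset.sum_range_succ, mul_add,
      add_comm]
    have h1 := ih (fun i hi j hj => hx i (Finset.mem_insert_of_mem hi) j
      (Finset.mem_insert_of_mem hj)) fun i hi => hy i (Finset.mem_insert_of_mem hi)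
    refine add_le_add h1 ?_
    have hr := hy a (Finset.mem_insert_self a s)
    have h2 := card_le_of_one_le_dist (insert a s) hx (dist_nonneg (x := y) (y := x a))
      (fun i hi => by
        rcases Finset.mem_insert.1 hi with rfl | hi
        · exact le_rfl
        · exact hmax i hi)
    rw [Finset.card_insert_of_notMem ha] at h2
    push_cast at h2
    set r := dist y (x a)
    have h3 : ((s.card : ℝ) + 1) ≤ (4 * r) ^ 2 := h2.trans (by gcongr; linarith)
    have h4 : ((4 * r) ^ 2) ^ (-(β / 2)) ≤ ((s.card : ℝ) + 1) ^ (-(β / 2)) :=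
      Real.rpow_le_rpow_of_nonpos (by positivity) h3 (by linarith)
    have h5 : ((4 * r) ^ 2) ^ (-(β / 2)) = 4 ^ (-β) * r ^ (-β) := by
      rw [← Real.rpow_natCast, ← Real.rpow_mul (by positivity),
        ← Real.mul_rpow (by norm_num) (by positivity)]
      congr 1; push_cast; ring
    have h6 : (1 / 16 : ℝ) ≤ 4 ^ (-β) := by
      calc (1 / 16 : ℝ) = 4 ^ (-2 : ℝ) := by rw [Real.rpow_neg (by norm_num)]; norm_num
        _ ≤ _ := Real.rpow_le_rpow_of_exponent_le (by norm_num) (by linarith)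
    have h7 : 0 ≤ r ^ (-β) := by positivity
    nlinarith

/-- Bound on the normalized force near a particle of a separated configuration of diameter at most
`2 * n`. -/
theorem norm_drift_le_rpow {n : ℕ} [NeZero n] {α : ℝ} (h0 : 0 ≤ α) (h1 : α < 1)
    {x : Fin n → Plane} (hx : ∀ i j, i ≠ j → 1 ≤ dist (x i) (x j))
    (hd : ∀ i j, dist (x i) (x j) ≤ 2 * n) {i : Fin n} {y : Plane}
    (hy : ∀ j, 1 / 2 ≤ dist y (x j)) (hyi : dist y (x i) ≤ 5) :
    ‖drift α x y‖ ≤ 224 / (1 - α) * (n : ℝ) ^ (-((1 - α) / 2)) := by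
  have hy' := notMem_range_of_half_le hy
  have hα : 0 < 1 - α := by linarith
  have hn : (1 : ℝ) ≤ n := by exact_mod_cast NeZero.one_le
  have hnpos : (0 : ℝ) < n := by linarith
  refine (norm_drift_le α hy').trans ?_
  -- Every particle is within `5 + 2 * n ≤ 7 * n` of `y`.
  have hQ : (n : ℝ) ^ (1 - α) / 7 ≤ riesz α x y := by
    have h2 : ∀ j, (7 * (n : ℝ)) ^ (-α) ≤ ‖y - x j‖ ^ (-α) := fun j => by
      refine Real.rpow_le_rpow_of_nonpos (norm_sub_pos_of_notMem hy' j) ?_ (by linarith)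
      rw [← dist_eq_norm]
      have := dist_triangle y (x i) (x j)
      have := hd i j
      linarith
    calc (n : ℝ) ^ (1 - α) / 7 = n * (7⁻¹ * (n : ℝ) ^ (-α)) := by
          rw [sub_eq_add_neg, Real.rpow_add hnpos, Real.rpow_one]; ring
      _ ≤ n * (7 * (n : ℝ)) ^ (-α) := by
          rw [Real.mul_rpow (by norm_num) hnpos.le]
          gcongr
          rw [← Real.rpow_neg_one]
          exact Real.rpow_le_rpow_of_exponent_le (by norm_num) (by linarith)
      _ = ∑ _j : Fin n, (7 * (n : ℝ)) ^ (-α) := by simp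
      _ ≤ _ := Finset.sum_le_sum fun j _ => h2 j
  have hS : ∑ j, ‖y - x j‖ ^ (-α - 1) ≤ 16 * ((n : ℝ) ^ ((1 - α) / 2) / ((1 - α) / 2)) := by
    have h2 := sum_dist_rpow_neg_le (β := α + 1) (by linarith) (by linarith) Finset.univ
      (fun i _ j _ => hx i j) (fun j _ => hy j)
    have h3 := sum_succ_rpow_neg_le (σ := (α + 1) / 2) (by linarith) (by linarith) n
    rw [Finset.card_univ, Fintype.card_fin] at h2
    rw [show 1 - (α + 1) / 2 = (1 - α) / 2 by ring] at h3
    calc ∑ j, ‖y - x j‖ ^ (-α - 1) = ∑ j, dist y (x j) ^ (-(α + 1)) := by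
          simp only [dist_eq_norm]
          rw [show -α - 1 = -(α + 1) by ring]
      _ ≤ _ := h2.trans (by gcongr)
  have hA : 0 < (n : ℝ) ^ ((1 - α) / 2) := Real.rpow_pos_of_pos hnpos _
  have hA2 : (n : ℝ) ^ (1 - α) = (n : ℝ) ^ ((1 - α) / 2) * (n : ℝ) ^ ((1 - α) / 2) := by
    rw [← Real.rpow_add hnpos]; congr 1; ring
  calc (∑ j, ‖y - x j‖ ^ (-α - 1)) / riesz α x y
      ≤ 16 * ((n : ℝ) ^ ((1 - α) / 2) / ((1 - α) / 2)) / ((n : ℝ) ^ (1 - α) / 7) := by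
        gcongr
    _ = 224 / (1 - α) * (n : ℝ) ^ (-((1 - α) / 2)) := by
        rw [hA2, Real.rpow_neg hnpos.le]
        field_simp
        norm_num

/-- The constant in the Beurling type estimate. -/
noncomputable def beurlingConst (α : ℝ) : ℝ := 112 * (224 / (1 - α))

/-- Beurling type estimate: a particle coming from infinity attaches to a given particle with
probability at most `C * n ^ (-(1 - α) / 2)`. -/
theorem IsLawFromInfinity.closedBall_le_rpow {n : ℕ} (hn : 1 ≤ n) {α : ℝ} (h0 : 0 ≤ α)
    (h1 : α < 1) {x : Fin n → Plane} (hx : ∀ i j, i ≠ j → 1 ≤ dist (x i) (x j))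
    (hd : ∀ i j, dist (x i) (x j) ≤ 2 * n) {ν : Measure Plane} (hν : IsLawFromInfinity α x ν)
    (i : Fin n) : ν (Metric.closedBall (x i) 1) ≤
      ENNReal.ofReal (beurlingConst α * (n : ℝ) ^ (-((1 - α) / 2))) := by
  have : NeZero n := ⟨by omega⟩
  have hα : 0 < 1 - α := by linarith
  have hnpos : (0 : ℝ) < n := by exact_mod_cast hn
  rw [beurlingConst, mul_assoc]
  exact hν.closedBall_le h0 h1.le (by positivity)
    fun y hy hyi => norm_drift_le_rpow h0 h1 hx hd hy hyi

end GFA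

/-! ### Chains of attachments and their expected number -/

namespace GFA

/-- The points of `u` are at distance at least `1`, and each point but the first one is at
distance `1` from one of its predecessors. -/
def IsAggregate (u : ℕ → Plane) : Prop :=
  ∀ n, 1 ≤ n → (∀ j < n, 1 ≤ dist (u n) (u j)) ∧ ∃ j < n, dist (u n) (u j) = 1

theorem IsAggregate.one_le_dist {u : ℕ → Plane} (hu : IsAggregate u) {i j : ℕ} (hij : i ≠ j) :
    1 ≤ dist (u i) (u j) := by
  rcases lt_or_gt_of_ne hij with h | h
  · rw [dist_comm]
    exact (hu j (by omega)).1 i h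
  · exact (hu i (by omega)).1 j h

theorem IsAggregate.dist_zero_le {u : ℕ → Plane} (hu : IsAggregate u) (k : ℕ) :
    dist (u k) (u 0) ≤ k := by
  induction k using Nat.strong_induction_on with
  | _ k ih =>
    rcases Nat.eq_zero_or_pos k with rfl | hk
    · simp
    obtain ⟨j, hj, hd⟩ := (hu k hk).2
    have h1 := ih j hj
    have h2 := dist_triangle (u k) (u j) (u 0)
    have h3 : (j : ℝ) + 1 ≤ k := by exact_mod_cast hj
    linarith

theorem IsAggregate.dist_le {u : ℕ → Plane} (hu : IsAggregate u) {n i j : ℕ} (hi : i < n)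
    (hj : j < n) : dist (u i) (u j) ≤ 2 * n := by
  have h1 := hu.dist_zero_le i
  have h2 := hu.dist_zero_le j
  have h3 := dist_triangle_right (u i) (u j) (u 0)
  have h4 : (i : ℝ) ≤ n := by exact_mod_cast hi.le
  have h5 : (j : ℝ) ≤ n := by exact_mod_cast hj.le
  linarith

open Classical in
/-- The number of chains `0 = i₀ < i₁ < ⋯ < i_L = k` such that consecutive points of the chain have
distance at most `1`. -/
noncomputable def chainCount (u : ℕ → Plane) : ℕ → ℕ → ENNReal
  | 0, k => if k = 0 then 1 else 0
  | L + 1, k => ∑ j ∈ Finset.range k, if dist (u k) (u j) ≤ 1 then chainCount u L j else 0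

theorem chainCount_congr {u v : ℕ → Plane} (L k : ℕ) (h : ∀ i ≤ k, u i = v i) :
    chainCount u L k = chainCount v L k := by
  induction L generalizing k with
  | zero => rfl
  | succ L ih =>
    refine Finset.sum_congr rfl fun j hj => ?_
    have hj := Finset.mem_range.1 hj
    rw [h k le_rfl, h j hj.le, ih j fun i hi => h i (by omega)]

theorem measurable_chainCount (L k : ℕ) : Measurable fun u : ℕ → Plane => chainCount u L k := by
  induction L generalizing k with
  | zero => exact measurable_const
  | succ L ih =>
    refine Finset.measurable_fun_sum _ fun j _ => Measurable.ite ?_ (ih j) measurable_const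
    exact measurableSet_le ((measurable_pi_apply k).dist (measurable_pi_apply j)) measurable_const

/-- The ancestral line of `k` is such a chain, and each link covers distance `1`. Its initial
segments provide chains of every smaller length, so that a single length can be tested later. -/
theorem IsAggregate.exists_chain {u : ℕ → Plane} (hu : IsAggregate u) (k : ℕ) :
    ∃ L : ℕ, 1 ≤ chainCount u L k ∧ dist (u k) (u 0) ≤ L ∧
      ∀ L' ≤ L, ∃ k' ≤ k, 1 ≤ chainCount u L' k' := by
  induction k using Nat.strong_induction_on with
  | _ k ih =>
    rcases Nat.eq_zero_or_pos k with rfl | hk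
    · refine ⟨0, by simp [chainCount], by simp, fun L' hL' => ⟨0, le_rfl, ?_⟩⟩
      obtain rfl : L' = 0 := by omega
      simp [chainCount]
    obtain ⟨j, hj, hd⟩ := (hu k hk).2
    obtain ⟨L, h1, h2, h3⟩ := ih j hj
    have h4 : 1 ≤ chainCount u (L + 1) k := by
      rw [chainCount]
      refine le_trans ?_ (Finset.single_le_sum (fun _ _ => zero_le) (Finset.mem_range.2 hj))
      rwa [if_pos hd.le]
    refine ⟨L + 1, h4, ?_, fun L' hL' => ?_⟩
    · have := dist_triangle (u k) (u j) (u 0)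
      push_cast
      linarith
    · rcases Nat.lt_or_ge L L' with h | h
      · obtain rfl : L' = L + 1 := by omega
        exact ⟨k, le_rfl, h4⟩
      · obtain ⟨k', hk', h5⟩ := h3 L' h
        exact ⟨k', by omega, h5⟩

theorem IsAggregate.dist_zero_le_of_sum_lt {u : ℕ → Plane} (hu : IsAggregate u) {N L : ℕ}
    (h : ∑ k ∈ Finset.range N, chainCount u L k < 1) {k : ℕ} (hk : k < N) :
    dist (u k) (u 0) ≤ L := by
  obtain ⟨L', -, h2, h3⟩ := hu.exists_chain k
  by_contra! hlt
  have h4 : L ≤ L' := by exact_mod_cast (hlt.trans_le h2).le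
  obtain ⟨k', hk', h5⟩ := h3 L h4
  refine absurd h (not_lt.2 (h5.trans ?_))
  exact Finset.single_le_sum (f := fun k => chainCount u L k) (fun _ _ => zero_le)
    (Finset.mem_range.2 (by omega))

variable {Ω : Type*} [MeasurableSpace Ω] {μ : Measure Ω} [IsProbabilityMeasure μ] {α : ℝ}
  {X : ℕ → Ω → Plane}

theorem IsGFA.measurable_prefix (hX : IsGFA μ α X) (n : ℕ) :
    Measurable fun (ω : Ω) (i : Fin n) => X i ω :=
  measurable_pi_lambda _ fun i => hX.measurable i

theorem IsGFA.lintegral_prefix (hX : IsGFA μ α X) (n : ℕ) {g : (Fin n → Plane) × Plane → ENNReal}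
    (hg : Measurable g) :
    ∫⁻ ω, g (fun i : Fin n => X i ω, X n ω) ∂μ =
      ∫⁻ ω, ∫⁻ y, g (fun i : Fin n => X i ω, y) ∂(condDistrib (X n)
        (fun (ω' : Ω) (i : Fin n) => X i ω') μ (fun i : Fin n => X i ω)) ∂μ := by
  have hp := hX.measurable_prefix n
  rw [← lintegral_map (f := g) hg (hp.prodMk (hX.measurable n)),
    ← compProd_map_condDistrib (hX.measurable n).aemeasurable, Measure.lintegral_compProd hg,
    lintegral_map hg.lintegral_kernel_prod_right' hp]

theorem IsGFA.ae_isAggregate (hX : IsGFA μ α X) : ∀ᵐ ω ∂μ, IsAggregate fun k => X k ω := by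
  unfold IsAggregate
  rw [ae_all_iff]
  intro n
  by_cases hn : 1 ≤ n
  swap
  · exact ae_of_all _ fun ω h => absurd h hn
  set S : Set ((Fin n → Plane) × Plane) :=
    {p | (∀ j, 1 ≤ dist p.2 (p.1 j)) ∧ ∃ j, dist p.2 (p.1 j) = 1} with hS
  have hSm : MeasurableSet S := by
    have h1 : S = (⋂ j, {p | 1 ≤ dist p.2 (p.1 j)}) ∩ ⋃ j, {p | dist p.2 (p.1 j) = 1} := by
      ext; simp [hS]
    have h2 : ∀ j : Fin n, Measurable fun p : (Fin n → Plane) × Plane => dist p.2 (p.1 j) :=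
      fun j => measurable_snd.dist ((measurable_pi_apply j).comp measurable_fst)
    rw [h1]
    exact (MeasurableSet.iInter fun j => measurableSet_le measurable_const (h2 j)).inter
      (MeasurableSet.iUnion fun j => measurableSet_eq_fun (h2 j) measurable_const)
  have h1 := hX.lintegral_prefix n (measurable_one.indicator hSm.compl)
  have h2 : ∫⁻ ω, ∫⁻ y, Sᶜ.indicator (1 : (Fin n → Plane) × Plane → ENNReal) (fun i : Fin n => X i ω, y) ∂(condDistrib
      (X n) (fun (ω' : Ω) (i : Fin n) => X i ω') μ (fun i : Fin n => X i ω)) ∂μ = 0 := by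
    rw [← lintegral_zero (μ := μ)]
    refine lintegral_congr_ae ?_
    filter_upwards [hX.step n hn] with ω hω
    rw [← lintegral_zero (μ := condDistrib (X n) (fun (ω' : Ω) (i : Fin n) => X i ω') μ
      (fun i : Fin n => X i ω))]
    refine lintegral_congr_ae ?_
    filter_upwards [hω.ae_stop] with y hy
    have hS' : (fun i : Fin n => X i ω, y) ∈ S := hy
    change Sᶜ.indicator (1 : (Fin n → Plane) × Plane → ENNReal) (fun i : Fin n => X i ω, y) = 0
    exact Set.indicator_of_notMem (Set.notMem_compl_iff.2 hS') _
  rw [h2] at h1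
  have h3 : Measurable fun ω => Sᶜ.indicator (1 : (Fin n → Plane) × Plane → ENNReal) (fun i : Fin n => X i ω, X n ω) :=
    (measurable_one.indicator hSm.compl).comp
      ((hX.measurable_prefix n).prodMk (hX.measurable n))
  rw [lintegral_eq_zero_iff h3] at h1
  filter_upwards [h1] with ω hω _
  have h4 : (fun i : Fin n => X i ω, X n ω) ∈ S := by
    by_contra h
    rw [Set.indicator_of_mem (show (fun i : Fin n => X i ω, X n ω) ∈ Sᶜ from h)] at hω
    exact one_ne_zero hω
  obtain ⟨h5, j, h6⟩ := h4
  exact ⟨fun j hj => h5 ⟨j, hj⟩, j, j.2, h6⟩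

/-- Conditionally on its predecessors, the particle `n` attaches to the particle `j` with a small
probability. -/
theorem IsGFA.lintegral_attach_le (hX : IsGFA μ α X) (h0 : 0 ≤ α) (h1 : α < 1) {n j : ℕ}
    (hj : j < n) (L : ℕ) :
    ∫⁻ ω, (if dist (X n ω) (X j ω) ≤ 1 then chainCount (fun k => X k ω) L j else 0) ∂μ ≤
      ENNReal.ofReal (beurlingConst α * (n : ℝ) ^ (-((1 - α) / 2))) *
        ∫⁻ ω, chainCount (fun k => X k ω) L j ∂μ := by
  -- The chain count up to `j < n` depends only on the first `n` points. Padding with `0` expresses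
  -- it as a function of the prefix on which the law is conditioned.
  set ext : (Fin n → Plane) → ℕ → Plane := fun v i => if h : i < n then v ⟨i, h⟩ else 0 with hext
  have hextm : Measurable ext := measurable_pi_lambda _ fun i => by
    by_cases h : i < n
    · simp only [hext, h, dite_true]
      exact measurable_pi_apply _
    · simp only [hext, h, dite_false]
      exact measurable_const
  have hc : ∀ ω, chainCount (ext fun i : Fin n => X i ω) L j = chainCount (fun k => X k ω) L j :=
    fun ω => chainCount_congr L j fun i hi => by
      have : i < n := by omega
      simp [hext, this]
  have hcm : Measurable fun v : Fin n → Plane => chainCount (ext v) L j :=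
    (measurable_chainCount L j).comp hextm
  have hset : MeasurableSet {p : (Fin n → Plane) × Plane | dist p.2 (p.1 ⟨j, hj⟩) ≤ 1} :=
    measurableSet_le (measurable_snd.dist ((measurable_pi_apply _).comp measurable_fst))
      measurable_const
  have hg : Measurable fun p : (Fin n → Plane) × Plane =>
      if dist p.2 (p.1 ⟨j, hj⟩) ≤ 1 then chainCount (ext p.1) L j else 0 :=
    Measurable.ite hset (hcm.comp measurable_fst) measurable_const
  have h2 := hX.lintegral_prefix n hg
  simp only [hc] at h2
  have hm : Measurable fun ω => chainCount (fun k => X k ω) L j :=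
    (measurable_chainCount L j).comp (measurable_pi_lambda _ fun k => hX.measurable k)
  rw [h2, ← lintegral_const_mul _ hm]
  refine lintegral_mono_ae ?_
  filter_upwards [hX.step n (by omega), hX.ae_isAggregate] with ω hω hagg
  have h3 := hω.closedBall_le_rpow (by omega) h0 h1
    (fun i j hij => hagg.one_le_dist fun h => hij (Fin.ext h))
    (fun i j => hagg.dist_le i.2 j.2) ⟨j, hj⟩
  set κ := condDistrib (X n) (fun (ω' : Ω) (i : Fin n) => X i ω') μ (fun i : Fin n => X i ω)
  calc ∫⁻ y, (if dist y (X j ω) ≤ 1 then chainCount (fun k => X k ω) L j else 0) ∂κ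
      = ∫⁻ y, (Metric.closedBall (X j ω) 1).indicator
          (fun _ => chainCount (fun k => X k ω) L j) y ∂κ := by
        refine lintegral_congr fun y => ?_
        by_cases hy : dist y (X j ω) ≤ 1
        · rw [if_pos hy, Set.indicator_of_mem (Metric.mem_closedBall.2 hy)]
        · rw [if_neg hy, Set.indicator_of_notMem fun h => hy (Metric.mem_closedBall.1 h)]
    _ = chainCount (fun k => X k ω) L j * κ (Metric.closedBall (X j ω) 1) := by
        rw [lintegral_indicator Metric.isClosed_closedBall.measurableSet, setLIntegral_const]
    _ ≤ _ := by
        rw [mul_comm]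
        gcongr

/-- These are the first two terms of the binomial expansion of `(a + b) ^ (L + 1)`; the inequality
drives the induction for the chain count. -/
theorem pow_div_factorial_add_le {a b : ℝ} (ha : 0 ≤ a) (hb : 0 ≤ b) (L : ℕ) :
    a ^ (L + 1) / (L + 1).factorial + b * (a ^ L / L.factorial) ≤
      (a + b) ^ (L + 1) / (L + 1).factorial := by
  have h : a ^ (L + 1) + (L + 1) * b * a ^ L ≤ (a + b) ^ (L + 1) := by
    have := pow_add_mul_le_add_pow ha (b := b) (by positivity) (L + 1)
    push_cast at this
    linarith
  rw [Nat.factorial_succ]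
  push_cast
  have hL : (0 : ℝ) < L.factorial := by positivity
  rw [div_add' _ _ _ (by positivity), div_le_div_iff_of_pos_right (by positivity)]
  refine le_trans (le_of_eq ?_) h
  field_simp

/-- Conditioning on the last link first, a chain costs the product of the attachment bounds at its
indices. Summing over increasing index sequences gives an elementary symmetric sum, at most the
`L`-th power of the total divided by `L!`. -/
theorem IsGFA.sum_lintegral_chainCount_le (hX : IsGFA μ α X) (h0 : 0 ≤ α) (h1 : α < 1)
    (L N : ℕ) :
    ∑ k ∈ Finset.range N, ∫⁻ ω, chainCount (fun k => X k ω) L k ∂μ ≤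
      ENNReal.ofReal ((∑ k ∈ Finset.range N, beurlingConst α * (k : ℝ) ^ (-((1 - α) / 2))) ^ L /
        L.factorial) := by
  have hC : 0 ≤ beurlingConst α := by
    have : 0 < 1 - α := by linarith
    unfold beurlingConst
    positivity
  have hp : ∀ k : ℕ, 0 ≤ beurlingConst α * (k : ℝ) ^ (-((1 - α) / 2)) := fun k => by positivity
  have hP : ∀ N, 0 ≤ ∑ k ∈ Finset.range N, beurlingConst α * (k : ℝ) ^ (-((1 - α) / 2)) :=
    fun N => Finset.sum_nonneg fun k _ => hp k
  induction L generalizing N with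
  | zero =>
    simp only [chainCount, lintegral_const, measure_univ, mul_one]
    rw [Finset.sum_ite_eq']
    split_ifs <;> simp
  | succ L ihL =>
    induction N with
    | zero => simp
    | succ N ihN =>
      rw [Finset.sum_range_succ, Finset.sum_range_succ _ N]
      have h2 : ∫⁻ ω, chainCount (fun k => X k ω) (L + 1) N ∂μ ≤
          ENNReal.ofReal (beurlingConst α * (N : ℝ) ^ (-((1 - α) / 2))) *
            ∑ k ∈ Finset.range N, ∫⁻ ω, chainCount (fun k => X k ω) L k ∂μ := by
        simp only [chainCount]
        rw [lintegral_finsetSum, Finset.mul_sum]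
        · exact Finset.sum_le_sum fun j hj =>
            hX.lintegral_attach_le h0 h1 (Finset.mem_range.1 hj) L
        · intro j _
          exact Measurable.ite (measurableSet_le ((hX.measurable N).dist (hX.measurable j))
            measurable_const) ((measurable_chainCount L j).comp
              (measurable_pi_lambda _ fun k => hX.measurable k)) measurable_const
      refine (add_le_add ihN (h2.trans (mul_le_mul_right (ihL N) _))).trans ?_
      rw [← ENNReal.ofReal_mul (hp N), ← ENNReal.ofReal_add (div_nonneg (pow_nonneg (hP N) _)
        (by positivity)) (mul_nonneg (hp N) (div_nonneg (pow_nonneg (hP N) _) (by positivity)))]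
      exact ENNReal.ofReal_le_ofReal (pow_div_factorial_add_le (hP N) (hp N) L)

end GFA

/-! ### Tail bounds and the diameter -/

namespace GFA

theorem pow_div_factorial_le_of_exp_mul_le {P : ℝ} (hP : 0 ≤ P) {L : ℕ} (h : Real.exp 2 * P ≤ L) :
    P ^ L / L.factorial ≤ Real.exp (-L) := by
  have h1 := Real.pow_div_factorial_le_exp _ (mul_nonneg (Real.exp_pos 2).le hP) L
  rw [mul_pow, ← Real.exp_nat_mul, mul_div_assoc] at h1
  calc P ^ L / L.factorial
      = Real.exp (-(L * 2)) * (Real.exp (L * 2) * (P ^ L / L.factorial)) := by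
        rw [← mul_assoc, ← Real.exp_add]; simp
    _ ≤ Real.exp (-(L * 2)) * Real.exp L := by gcongr; exact h1.trans (Real.exp_le_exp.2 h)
    _ = Real.exp (-L) := by rw [← Real.exp_add]; congr 1; ring

theorem exp_neg_le_div_sq {L N : ℕ} (hN : 1 ≤ N) (h : (N : ℝ) ^ (1 / 2 : ℝ) ≤ L) :
    Real.exp (-L) ≤ 24 * (1 / (N : ℝ) ^ 2) := by
  have hN' : (0 : ℝ) < N := by exact_mod_cast hN
  have h1 := Real.pow_div_factorial_le_exp _ (Nat.cast_nonneg (α := ℝ) L) 4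
  have h2 : (N : ℝ) ^ 2 ≤ (L : ℝ) ^ 4 := by
    calc (N : ℝ) ^ 2 = ((N : ℝ) ^ (1 / 2 : ℝ)) ^ 4 := by
          rw [← Real.rpow_natCast, ← Real.rpow_natCast, ← Real.rpow_mul hN'.le]; norm_num
      _ ≤ _ := by gcongr
  rw [Real.exp_neg, mul_one_div, inv_le_comm₀ (Real.exp_pos _) (by positivity), inv_div]
  refine le_trans ?_ h1
  norm_num [Nat.factorial]
  linarith

theorem sum_beurlingConst_le {α : ℝ} (h0 : 0 ≤ α) (h1 : α < 1) (N : ℕ) :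
    ∑ k ∈ Finset.range N, beurlingConst α * (k : ℝ) ^ (-((1 - α) / 2)) ≤
      2 * beurlingConst α * (N : ℝ) ^ ((1 + α) / 2) := by
  have hα : 0 < 1 - α := by linarith
  have hC : 0 ≤ beurlingConst α := by unfold beurlingConst; positivity
  rcases N with _ | N
  · simp [Real.zero_rpow (show (1 + α) / 2 ≠ 0 by positivity)]
  -- The term `k = 0` vanishes by the convention that `0` to a nonzero real power is `0`.
  rw [Finset.sum_range_succ', ← Finset.mul_sum, Nat.cast_zero, Real.zero_rpow (by linarith),
    mul_zero, add_zero]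
  have h2 := sum_succ_rpow_neg_le (σ := (1 - α) / 2) (by linarith) (by linarith) N
  rw [show 1 - (1 - α) / 2 = (1 + α) / 2 by ring] at h2
  have h3 : (N : ℝ) ^ ((1 + α) / 2) ≤ ((N + 1 : ℕ) : ℝ) ^ ((1 + α) / 2) := by
    gcongr
    exact_mod_cast N.le_succ
  have h4 : (N : ℝ) ^ ((1 + α) / 2) / ((1 + α) / 2) ≤ 2 * (N : ℝ) ^ ((1 + α) / 2) := by
    rw [div_le_iff₀ (by positivity)]
    have : 0 ≤ (N : ℝ) ^ ((1 + α) / 2) := by positivity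
    nlinarith
  push_cast at h3 ⊢
  calc beurlingConst α * ∑ k ∈ Finset.range N, ((k : ℝ) + 1) ^ (-((1 - α) / 2))
      ≤ beurlingConst α * (2 * ((N : ℝ) + 1) ^ ((1 + α) / 2)) := by
        gcongr
        linarith
    _ = _ := by ring

variable {Ω : Type*} {X : ℕ → Ω → Plane}

theorem clusterDiam_le {N : ℕ} {ω : Ω} {B : ℝ} (hB : 0 ≤ B)
    (h : ∀ k < N, dist (X k ω) (X 0 ω) ≤ B) : clusterDiam X N ω ≤ 2 * B := by
  refine Metric.diam_le_of_forall_dist_le (by positivity) ?_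
  rintro _ ⟨i, hi, rfl⟩ _ ⟨j, hj, rfl⟩
  have := dist_triangle_right (X i ω) (X j ω) (X 0 ω)
  linarith [h i hi, h j hj]

theorem dist_le_clusterDiam {N i j : ℕ} {ω : Ω} (hi : i < N) (hj : j < N) :
    dist (X i ω) (X j ω) ≤ clusterDiam X N ω := by
  have hfin : {p : Plane | ∃ k < N, X k ω = p}.Finite := by
    have : {p : Plane | ∃ k < N, X k ω = p} = (fun k => X k ω) '' Set.Iio N := by
      ext; simp
    rw [this]
    exact (Set.finite_Iio N).image _
  exact Metric.dist_le_diam_of_mem hfin.isBounded ⟨i, hi, rfl⟩ ⟨j, hj, rfl⟩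

theorem IsAggregate.le_clusterDiam {ω : Ω} (hu : IsAggregate fun k => X k ω) {N : ℕ}
    (hN : 2 ≤ N) : 1 / 8 * (N : ℝ) ^ (1 / 2 : ℝ) ≤ clusterDiam X N ω := by
  have hD : 0 ≤ clusterDiam X N ω := Metric.diam_nonneg
  have h1 := card_le_of_one_le_dist (Finset.range N) (x := fun k => X k ω) (y := X 0 ω)
    (fun i _ j _ hij => hu.one_le_dist hij) hD fun i hi =>
      dist_le_clusterDiam (by omega) (Finset.mem_range.1 hi)
  rw [Finset.card_range] at h1
  have hN' : (2 : ℝ) ≤ N := by exact_mod_cast hN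
  rw [← Real.sqrt_eq_rpow]
  have h2 : √(N : ℝ) ≤ 2 * clusterDiam X N ω + 1 := Real.sqrt_le_iff.2 ⟨by positivity, h1⟩
  -- This absorbs the `1` in `√N ≤ 2 * diam + 1`: it gives `√N - 1 ≥ √N / 4`.
  have h3 : (4 / 3 : ℝ) ≤ √(N : ℝ) := Real.le_sqrt_of_sq_le (by linarith)
  linarith

variable [MeasurableSpace Ω] {μ : Measure Ω} [IsProbabilityMeasure μ] {α : ℝ}

/-- The length of attachment chains that is unlikely to occur among the first `N` particles. -/
noncomputable def chainBound (α : ℝ) (N : ℕ) : ℕ :=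
  ⌈(1 + Real.exp 2 * (2 * beurlingConst α)) * (N : ℝ) ^ ((1 + α) / 2)⌉₊

theorem beurlingConst_pos (h1 : α < 1) : 0 < beurlingConst α := by
  have hα : 0 < 1 - α := by linarith
  unfold beurlingConst
  positivity

/-- Markov's inequality for the number of chains. In `chainBound`, the summand with `exp 2` makes
the expectation at most `exp (-L)`, and the summand `1` makes `L ≥ √N`, hence `exp (-L) ≤ 24 / N ^
2`, which is summable. -/
theorem IsGFA.measure_long_chain_le (hX : IsGFA μ α X) (h0 : 0 ≤ α) (h1 : α < 1) {N : ℕ}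
    (hN : 1 ≤ N) :
    μ {ω | 1 ≤ ∑ k ∈ Finset.range N, chainCount (fun k => X k ω) (chainBound α N) k} ≤
      ENNReal.ofReal (24 * (1 / (N : ℝ) ^ 2)) := by
  have hm : ∀ k, Measurable fun ω => chainCount (fun k => X k ω) (chainBound α N) k := fun k =>
    (measurable_chainCount _ k).comp (measurable_pi_lambda _ fun k => hX.measurable k)
  have h2 := mul_meas_ge_le_lintegral (μ := μ) (Finset.measurable_fun_sum (Finset.range N)
    fun k _ => hm k) 1
  rw [one_mul, lintegral_finsetSum _ fun k _ => hm k] at h2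
  refine (h2.trans (hX.sum_lintegral_chainCount_le h0 h1 _ N)).trans
    (ENNReal.ofReal_le_ofReal ?_)
  have hC := (beurlingConst_pos h1).le
  have hN' : (1 : ℝ) ≤ N := by exact_mod_cast hN
  have hL : (1 + Real.exp 2 * (2 * beurlingConst α)) * (N : ℝ) ^ ((1 + α) / 2) ≤ chainBound α N :=
    Nat.le_ceil _
  have hpos : 0 ≤ (N : ℝ) ^ ((1 + α) / 2) := by positivity
  have he : 0 ≤ Real.exp 2 * (2 * beurlingConst α) := by positivity
  refine (pow_div_factorial_le_of_exp_mul_le (Finset.sum_nonneg fun k _ => by positivity) ?_).trans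
    (exp_neg_le_div_sq hN ?_)
  · refine (mul_le_mul_of_nonneg_left (sum_beurlingConst_le h0 h1 N) (Real.exp_pos 2).le).trans ?_
    nlinarith
  · have : (N : ℝ) ^ (1 / 2 : ℝ) ≤ (N : ℝ) ^ ((1 + α) / 2) :=
      Real.rpow_le_rpow_of_exponent_le hN' (by linarith)
    nlinarith

theorem two_mul_chainBound_le (h0 : 0 ≤ α) (h1 : α < 1) {N : ℕ} (hN : 1 ≤ N) :
    2 * (chainBound α N : ℝ) ≤ 2 * (2 + Real.exp 2 * (2 * beurlingConst α)) *
      (N : ℝ) ^ ((3 * α + 1) / (2 * α + 2)) := by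
  have hN' : (1 : ℝ) ≤ N := by exact_mod_cast hN
  have hC := (beurlingConst_pos h1).le
  -- Cross-multiplied, the comparison of exponents reads `(1 + α) ^ 2 ≤ 3 * α + 1`, that is `α ^ 2 ≤
  -- α`.
  have h2 : (N : ℝ) ^ ((1 + α) / 2) ≤ (N : ℝ) ^ ((3 * α + 1) / (2 * α + 2)) := by
    refine Real.rpow_le_rpow_of_exponent_le hN' ?_
    rw [div_le_div_iff₀ (by norm_num) (by positivity)]
    nlinarith
  have h3 : 1 ≤ (N : ℝ) ^ ((1 + α) / 2) := Real.one_le_rpow hN' (by positivity)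
  have h4 : (chainBound α N : ℝ) < _ := Nat.ceil_lt_add_one (by positivity)
  have h5 : 0 ≤ Real.exp 2 * (2 * beurlingConst α) := by positivity
  nlinarith

/-- If the failure probabilities of the events `S n` are summable, then `S n` holds with
probability tending to `1`, and almost surely for all large `n`. -/
theorem tendsto_and_ae_eventually {S B : ℕ → Set Ω} {c : ℝ} (hc : 0 ≤ c)
    (hB : ∀ n, 1 ≤ n → μ (B n) ≤ ENNReal.ofReal (c * (1 / (n : ℝ) ^ 2)))
    (hS : ∀ᵐ ω ∂μ, ∀ n, 1 ≤ n → ω ∉ B n → ω ∈ S n) :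
    Tendsto (fun n => μ (S n)) atTop (𝓝 1) ∧ ∀ᵐ ω ∂μ, ∀ᶠ n in atTop, ω ∈ S n := by
  have hsum : Summable fun n : ℕ => c * (1 / (n : ℝ) ^ 2) :=
    (Real.summable_one_div_nat_pow.2 one_lt_two).mul_left c
  constructor
  · have h1 : Tendsto (fun n : ℕ => 1 - ENNReal.ofReal (c * (1 / (n : ℝ) ^ 2))) atTop (𝓝 1) := by
      have := ENNReal.Tendsto.sub (tendsto_const_nhds (x := (1 : ENNReal)))
        (ENNReal.tendsto_ofReal hsum.tendsto_atTop_zero) (Or.inl ENNReal.one_ne_top)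
      simpa using this
    refine tendsto_of_tendsto_of_tendsto_of_le_of_le' h1 tendsto_const_nhds ?_
      (Eventually.of_forall fun n => prob_le_one)
    filter_upwards [eventually_ge_atTop 1] with n hn
    rw [tsub_le_iff_right, ← measure_univ (μ := μ)]
    have h2 : μ Set.univ ≤ μ (S n ∪ B n) := by
      refine measure_mono_ae ?_
      filter_upwards [hS] with ω hω _
      by_cases h : ω ∈ B n
      · exact Or.inr h
      · exact Or.inl (hω n hn h)
    exact h2.trans ((measure_union_le _ _).trans (by gcongr; exact hB n hn))
  · have h1 : ∑' n, μ (B (n + 1)) ≠ ⊤ := by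
      refine ne_top_of_le_ne_top ?_ (ENNReal.tsum_le_tsum fun n => hB (n + 1) (by omega))
      have h2 := (summable_nat_add_iff 1).2 hsum
      rw [← ENNReal.ofReal_tsum_of_nonneg (fun n => by positivity) h2]
      exact ENNReal.ofReal_ne_top
    filter_upwards [ae_eventually_notMem h1, hS] with ω h2 h3
    obtain ⟨m, hm⟩ := eventually_atTop.1 h2
    refine eventually_atTop.2 ⟨m + 1, fun n hn => ?_⟩
    have h4 := hm (n - 1) (by omega)
    rw [show n - 1 + 1 = n by omega] at h4
    exact h3 n (by omega) h4

end GFA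

theorem theorem3 (α : ℝ) (hα0 : 0 ≤ α) (hα1 : α ≤ 1) :
    (∃ c : ℝ, 0 < c ∧
      ∀ (Ω : Type*) [MeasurableSpace Ω] (μ : Measure Ω) [IsProbabilityMeasure μ]
        (X : ℕ → Ω → GFA.Plane), GFA.IsGFA μ α X →
        (∀ᵐ ω ∂μ, ∀ n : ℕ, 1 ≤ n → GFA.PropertyP α (fun i : Fin n => X i ω)) →
        Tendsto (fun n : ℕ => μ {ω | GFA.clusterDiam X n ω ≤
            c * (n : ℝ) ^ ((3 * α + 1) / (2 * α + 2))}) atTop (𝓝 1) ∧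
        ∀ᵐ ω ∂μ, ∀ᶠ n : ℕ in atTop, GFA.clusterDiam X n ω ≤
            c * (n : ℝ) ^ ((3 * α + 1) / (2 * α + 2))) ∧
    (α = 0 → ∃ c : ℝ, 0 < c ∧
      ∀ (Ω : Type*) [MeasurableSpace Ω] (μ : Measure Ω) [IsProbabilityMeasure μ]
        (X : ℕ → Ω → GFA.Plane), GFA.IsGFA μ α X →
        ∀ᵐ ω ∂μ, ∀ n : ℕ, 2 ≤ n → c * (n : ℝ) ^ (1 / 2 : ℝ) ≤ GFA.clusterDiam X n ω) := by
  refine ⟨?_, fun _ => ⟨1 / 8, by norm_num, fun Ω _ μ _ X hX => ?_⟩⟩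
  · rcases hα1.lt_or_eq with h1 | rfl
    · have hC := (GFA.beurlingConst_pos h1).le
      refine ⟨2 * (2 + Real.exp 2 * (2 * GFA.beurlingConst α)), by positivity,
        fun Ω _ μ _ X hX _ => ?_⟩
      refine GFA.tendsto_and_ae_eventually (c := 24) (by norm_num)
        (fun n hn => hX.measure_long_chain_le hα0 h1 hn) ?_
      filter_upwards [hX.ae_isAggregate] with ω hω n hn hB
      refine le_trans (GFA.clusterDiam_le (Nat.cast_nonneg (GFA.chainBound α n)) fun k hk => ?_)
        (GFA.two_mul_chainBound_le hα0 h1 hn)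
      exact hω.dist_zero_le_of_sum_lt (not_le.1 hB) hk
    -- For `α = 1` the exponent is `1`; particle `k` is within distance `k` of the first, so there
    -- are no exceptional events.
    · refine ⟨2, two_pos, fun Ω _ μ _ X hX _ => ?_⟩
      refine GFA.tendsto_and_ae_eventually (B := fun _ => ∅) (c := 0) le_rfl (fun n _ => by simp) ?_
      filter_upwards [hX.ae_isAggregate] with ω hω n hn _
      have h2 : (n : ℝ) ^ ((3 * (1 : ℝ) + 1) / (2 * 1 + 2)) = n := by norm_num
      change GFA.clusterDiam X n ω ≤ _
      rw [h2]
      refine GFA.clusterDiam_le n.cast_nonneg fun k hk => (hω.dist_zero_le k).trans ?_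
      exact_mod_cast hk.le
  · filter_upwards [hX.ae_isAggregate] with ω hω n hn
    exact hω.le_clusterDiam hn
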